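/- **Theorem 1.3.** Let $G(z)=\sum_{n\ge 0}\xi_n z^n/\sqrt{n!}$ be the flat Gaussian analytic function (GAF), where $\xi_0,\xi_1,\dots$ are i.i.d. standard complex Gaussian variables (density $\pi^{-1}e^{-|z|^2}$). For $\tau\in\mathbb C$ let $D=d/dz$ and $$e^{-\tau D^2/2}F(z)=\sum_{k=0}^\infty \frac1{k!}\Big(\frac{-\tau}{2}\Big)^k D^{2k}F(z).$$ For $a\in\mathbb C$ let $G^a$ be the GAF conditioned on $G(a)=0$; that is, its law is the value at $w=0$ of the regular conditional distribution of $G$ given $G(a)=w$, taken in a version whose finite-dimensional distributions are weakly continuous in $w$ at $w=0$. Then: 1. The law of $G^a$ exists and is unique. Almost surely $a$ is a simple zero of $G^a$, and there is a holomorphic function $z^a$ on some (random) disk around $0$, unique on any disk around $0$ on which it exists, such that $z^a(0)=a$ and $(e^{-\tau D^2/2}G^a)(z^a(\tau))=0$ (with convergent heat-flow series) for all $\tau$ in that disk. 2. For every $a\in\mathbb C$, $$z^a(\tau)\ \overset{d}{=}\ a+\tau\bar a+z^0(\tau)$$ as random holomorphic functions of $\tau$ defined on a random disk around $0$. Explicitly: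 - the germs at $\tau=0$ of the two sides have the same law, i.e. their sequences of Taylor coefficients at $0$ have the same law in $\mathbb C^{\mathbb N}$; - for every $0<r\le 1$, all $\tau_1,\dots,\tau_n$ with $|\tau_i|<r$, and every Borel set $B\subset\mathbb C^n$, the probability that $z^a$ exists on $\{|\tau|<r\}$ and $(z^a(\tau_i))_{i\le n}\in B$ equals the probability that $z^0$ exists on $\{|\tau|<r\}$ and $(a+\tau_i\bar a+z^0(\tau_i))_{i\le n}\in B$. -/

import Mathlib

open MeasureTheory ProbabilityTheory Metric

/-- Entire functions of one complex variable.  As a subtype of `ℂ → ℂ` it carries the σ-algebra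
generated by the point evaluations. -/
abbrev EntireFun : Type := {f : ℂ → ℂ // Differentiable ℂ f}

/-- The standard complex Gaussian distribution, with Lebesgue density `π⁻¹ exp (-|z|²)`. -/
noncomputable def stdComplexGaussian : Measure ℂ :=
  (volume : Measure ℂ).withDensity
    (fun z => ENNReal.ofReal (Real.pi⁻¹ * Real.exp (-‖z‖ ^ 2)))

/-- `G` is a (flat) Gaussian analytic function on the probability space `(Ω, P)`: almost surely
`G(z) = ∑ ξₙ zⁿ / √(n!)` for all `z`, where the `ξₙ` are i.i.d. standard complex Gaussian. -/
def IsGAF {Ω : Type*} [MeasurableSpace Ω] (P : Measure Ω) (G : Ω → EntireFun) : Prop :=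
  ∃ ξ : ℕ → Ω → ℂ,
    (∀ n, HasLaw (ξ n) stdComplexGaussian P) ∧
    iIndepFun ξ P ∧
    ∀ᵐ ω ∂P, ∀ z : ℂ,
      HasSum (fun n : ℕ => ξ n ω * (z ^ n / (Real.sqrt (n.factorial : ℝ) : ℂ))) ((G ω).1 z)

/-- `ν` is the conditional law of the random entire function `G` given `G(a) = 0`.  As this event
is null, this is understood in the usual way: `ν = κ 0`, where `w ↦ κ w` is a regular conditional
distribution of `G` given the random variable `G(a)` (a disintegration of the joint law) whose
finite-dimensional distributions depend weakly continuously on `w` at `w = 0`. -/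
def IsLawGivenZeroAt {Ω : Type*} [MeasurableSpace Ω] (P : Measure Ω) (G : Ω → EntireFun)
    (a : ℂ) (ν : Measure EntireFun) : Prop :=
  ∃ κ : Kernel ℂ EntireFun, IsMarkovKernel κ ∧
    P.map (fun ω => ((G ω).1 a, G ω)) = (P.map (fun ω => (G ω).1 a)).compProd κ ∧
    (∀ (n : ℕ) (z : Fin n → ℂ) (f : BoundedContinuousFunction (Fin n → ℂ) ℝ),
      ContinuousAt (fun w : ℂ => ∫ g, f (fun i => g.1 (z i)) ∂(κ w)) 0) ∧
    ν = κ 0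

/-- The random entire function `X` on `(Ω', P')` is distributed as `G` conditioned on
`G(a) = 0`. -/
def IsConditionedAt {Ω Ω' : Type*} [MeasurableSpace Ω] [MeasurableSpace Ω']
    (P : Measure Ω) (G : Ω → EntireFun) (a : ℂ) (P' : Measure Ω') (X : Ω' → EntireFun) : Prop :=
  ∃ ν : Measure EntireFun, IsLawGivenZeroAt P G a ν ∧ HasLaw X ν P'

/-- The `k`-th term `(1/k!) (-τ/2)^k D^{2k} F(z)` of the heat-flow series. -/
noncomputable def heatTerm (τ : ℂ) (F : ℂ → ℂ) (z : ℂ) (k : ℕ) : ℂ :=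
  (1 / (k.factorial : ℂ)) * (-τ / 2) ^ k * iteratedDeriv (2 * k) F z

/-- The heat-flow operator `e^{-τD²/2}` (meaningful where the series converges). -/
noncomputable def heatFlow (τ : ℂ) (F : ℂ → ℂ) (z : ℂ) : ℂ :=
  ∑' k : ℕ, heatTerm τ F z k

/-- On the disk `|τ| < r`, `ζ` is holomorphic, starts at `a`, and `ζ τ` is a zero of
`e^{-τD²/2} F` (in particular the heat-flow series converges at `ζ τ`). -/
def IsHeatZeroPath (F : ℂ → ℂ) (a : ℂ) (r : ℝ) (ζ : ℂ → ℂ) : Prop :=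
  DifferentiableOn ℂ ζ (ball 0 r) ∧ ζ 0 = a ∧
    ∀ τ ∈ ball (0 : ℂ) r, Summable (heatTerm τ F (ζ τ)) ∧ heatFlow τ F (ζ τ) = 0

/-- `z` is a version of the random holomorphic function germ `z^a`: almost surely, `z ω` is
holomorphic on some (random) disk around `0`, starts at `a`, and follows a zero of
`e^{-τD²/2} (X ω)` there. -/
def IsRandomHeatZero {Ω : Type*} [MeasurableSpace Ω] (P : Measure Ω) (X : Ω → EntireFun) (a : ℂ)
    (z : Ω → ℂ → ℂ) : Prop :=
  ∀ᵐ ω ∂P, ∃ r : ℝ, 0 < r ∧ IsHeatZeroPath (X ω).1 a r (z ω)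

/-- The event that the zero starting at `a` can be followed holomorphically on the whole disk
`|τ| < r`, and that the shifted positions `m (t i) + ζ (t i)` at the times `t i` lie in `B`. -/
def heatZeroEvent {Ω : Type*} (X : Ω → EntireFun) (a : ℂ) (r : ℝ) (m : ℂ → ℂ) {n : ℕ}
    (t : Fin n → ℂ) (B : Set (Fin n → ℂ)) : Set Ω :=
  {ω | ∃ ζ : ℂ → ℂ, IsHeatZeroPath (X ω).1 a r ζ ∧ (fun i => m (t i) + ζ (t i)) ∈ B}

/-- The Taylor coefficients at `0` of a function holomorphic near `0`; they determine the germ, and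
generate the σ-algebra on the space of germs. -/
noncomputable def taylorSeq (f : ℂ → ℂ) : ℕ → ℂ :=
  fun k => iteratedDeriv k f 0 / (k.factorial : ℂ)

/-!
The flat GAF is invariant in law under the Fock-space translations `T_a F(z) = exp(ā z - |a|²/2)
F(z - a)`, because its covariance kernel `exp(z w̄)` is; so the GAF conditioned to vanish at `a`
is `T_a` applied to the GAF conditioned to vanish at `0`, which is just the Gaussian series
without its constant term. On the other hand the heat flow intertwines with `T_a`:

  `e^{-τD²/2} (T_a F)(z) = exp(ā z - |a|²/2 - τ ā²/2) (e^{-τD²/2} F)(z - a - τ ā)`,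

so the zero path of `T_a F` from `a` is `a + τ ā` plus the zero path of `F` from `0`
(`HeatTame.isHeatZeroPath_fockShift_iff`). These two facts give the equality in distribution.

Conditional law. Resampling the value `G(0)` and translating by `a` preserves the law of `G`
(`IsGAF.map_resetAt`, by comparing characteristic functions of finite linear combinations of
values), which exhibits an explicit disintegration `resetKernel` of the law of `G` over `G(a)`,
weakly continuous in the value. Any two disintegrations agree for almost every value, hence at `0`
by continuity, since `G(a)` charges every open set (`IsGAF.isLawGivenZeroAt_unique`).

Zero paths. Almost surely the coefficients of the Gaussian series grow at most polynomially, so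
the heat flow is jointly holomorphic for `|τ| < 1` and satisfies `∂_τ H = -½ ∂_z² H`. A simple
zero can then be followed by the implicit function theorem, and `ζ' = ½ H'' / H'` expresses its
Taylor coefficients through the jet of `F` at `0` (`IsHeatZeroPath.taylorSeq_eq`). Hence the path
is unique and depends measurably on `F`, and for `r ≤ 1` its existence on `|τ| < r` amounts to
convergence of its Taylor series there (`HeatTame.exists_isHeatZeroPath_iff`).
-/

/-! ### The heat flow on entire functions of Gaussian growth -/

/-- The class of entire functions to which the heat flow `e^{-τD²/2}` applies for all `|τ| < 1`:
for every `ρ < 1`, `|F⁽ⁿ⁾(z)| ≤ C ρ⁻ⁿ √(n!)`, with `C` uniform for `z` in a bounded set. Allowing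
every `ρ < 1` (rather than `ρ = 1`) makes the class stable under differentiation and under moving
the base point. -/
def HeatTame (F : ℂ → ℂ) : Prop :=
  Differentiable ℂ F ∧ ∀ ρ : ℝ, 0 < ρ → ρ < 1 → ∀ R : ℝ, ∃ C : ℝ, ∀ (n : ℕ) (z : ℂ), ‖z‖ ≤ R →
    ‖iteratedDeriv n F z‖ * ρ ^ n ≤ C * √(n.factorial : ℝ)

lemma sqrt_factorial_two_mul_le (k : ℕ) :
    √((2 * k).factorial : ℝ) ≤ 2 ^ k * (k.factorial : ℝ) := by
  rw [Real.sqrt_le_left (by positivity)]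
  have h : (2 * k).factorial ≤ (2 ^ k * k.factorial) ^ 2 := by
    have h2 : (2 * k).choose k * k.factorial * k.factorial = (2 * k).factorial := by
      have := Nat.choose_mul_factorial_mul_factorial (show k ≤ 2 * k by omega)
      rwa [show 2 * k - k = k by omega] at this
    have h3 : (2 * k).choose k ≤ 2 ^ (2 * k) := Nat.choose_le_two_pow _ _
    calc (2 * k).factorial = (2 * k).choose k * (k.factorial * k.factorial) := by
          rw [← h2, mul_assoc]
      _ ≤ 2 ^ (2 * k) * (k.factorial * k.factorial) := Nat.mul_le_mul_right _ h3
      _ = _ := by ring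
  exact_mod_cast h

/-- Since `√((2k)!) ≤ 2ᵏ k!`, the heat-flow series is dominated by a geometric series of ratio
`|τ| / ρ²`, uniformly for `|τ| ≤ q < 1` and bounded `z`. -/
lemma HeatTame.exists_bound {F : ℂ → ℂ} (hF : HeatTame F) {q : ℝ} (hq : q < 1) (R : ℝ) :
    ∃ u : ℕ → ℝ, Summable u ∧ ∀ (k : ℕ) (τ z : ℂ), ‖τ‖ ≤ q → ‖z‖ ≤ R →
      ‖heatTerm τ F z k‖ ≤ u k := by
  rcases lt_or_ge q 0 with h0 | h0
  · exact ⟨fun _ => 0, summable_zero, fun k τ z hτ _ =>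
      absurd ((norm_nonneg τ).trans hτ) (not_le.2 h0)⟩
  -- any `ρ` with `q < ρ² < 1` makes the dominating series geometric of ratio `q / ρ² < 1`
  set ρ := √((1 + q) / 2) with hρ
  have hρ2 : ρ ^ 2 = (1 + q) / 2 := Real.sq_sqrt (by linarith)
  have hρ0 : 0 < ρ := Real.sqrt_pos.2 (by linarith)
  have hρ1 : ρ < 1 := by
    rw [hρ, Real.sqrt_lt' one_pos]; linarith
  obtain ⟨C, hC⟩ := hF.2 ρ hρ0 hρ1 R
  refine ⟨fun k => C * (q / ρ ^ 2) ^ k, ?_, fun k τ z hτ hz => ?_⟩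
  · refine (summable_geometric_of_lt_one (by positivity) ?_).mul_left C
    rw [div_lt_one (by positivity), hρ2]; linarith
  · have h1 := hC (2 * k) z hz
    have hC0 : 0 ≤ C := by
      have := hC 0 z hz
      simp only [pow_zero, mul_one, Nat.factorial_zero, Nat.cast_one, Real.sqrt_one] at this
      exact (norm_nonneg _).trans this
    have h2 : ‖iteratedDeriv (2 * k) F z‖ ≤ C * (2 ^ k * k.factorial) / (ρ ^ 2) ^ k := by
      rw [le_div_iff₀ (by positivity), ← pow_mul]
      exact h1.trans (mul_le_mul_of_nonneg_left (sqrt_factorial_two_mul_le k) hC0)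
    have hk : (0 : ℝ) < k.factorial := by exact_mod_cast k.factorial_pos
    calc ‖heatTerm τ F z k‖ = (1 / k.factorial) * (‖τ‖ / 2) ^ k * ‖iteratedDeriv (2 * k) F z‖ := by
          simp [heatTerm]
      _ ≤ (1 / k.factorial) * (q / 2) ^ k * (C * (2 ^ k * k.factorial) / (ρ ^ 2) ^ k) := by
          gcongr
      _ = C * (q / ρ ^ 2) ^ k := by
          rw [div_pow, div_pow]; field_simp

lemma HeatTame.deriv_tame {F : ℂ → ℂ} (hF : HeatTame F) : HeatTame (deriv F) := by
  refine ⟨hF.1.contDiff.differentiable_deriv_two, fun ρ hρ0 hρ1 R => ?_⟩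
  -- the extra factor `√(n + 1)` is absorbed by passing from `ρ` to the larger radius `√ρ`
  set σ := √ρ
  have hσ0 : 0 < σ := Real.sqrt_pos.2 hρ0
  have hσ1 : σ < 1 := by rw [Real.sqrt_lt' one_pos]; linarith
  have hσρ : σ ^ 2 = ρ := Real.sq_sqrt hρ0.le
  obtain ⟨C, hC⟩ := hF.2 σ hσ0 hσ1 R
  obtain ⟨M, hM⟩ := (tendsto_self_mul_const_pow_of_lt_one hσ0.le hσ1).bddAbove_range
  refine ⟨|C| * (M + 1) / σ , fun n z hz => ?_⟩
  have h1 := hC (n + 1) z hz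
  rw [iteratedDeriv_succ'] at h1
  have h2 : (n : ℝ) * σ ^ n ≤ M := hM ⟨n, rfl⟩
  have h3 : √((n + 1).factorial : ℝ) ≤ (n + 1) * √(n.factorial : ℝ) := by
    rw [Nat.factorial_succ]; push_cast
    rw [Real.sqrt_mul (by positivity)]
    gcongr
    rw [Real.sqrt_le_left (by positivity)]
    nlinarith [(Nat.cast_nonneg n : (0 : ℝ) ≤ n)]
  have h4 : σ ^ n ≤ 1 := pow_le_one₀ hσ0.le hσ1.le
  rw [div_mul_eq_mul_div, le_div_iff₀ hσ0]
  calc ‖iteratedDeriv n (deriv F) z‖ * ρ ^ n * σ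
      = (‖iteratedDeriv n (deriv F) z‖ * σ ^ (n + 1)) * σ ^ n := by
        rw [← hσρ]; ring
    _ ≤ (|C| * ((n + 1) * √(n.factorial : ℝ))) * σ ^ n := by
        refine mul_le_mul_of_nonneg_right (h1.trans ?_) (by positivity)
        gcongr
        exact le_abs_self C
    _ = |C| * (n * σ ^ n + σ ^ n) * √(n.factorial : ℝ) := by ring
    _ ≤ |C| * (M + 1) * √(n.factorial : ℝ) := by gcongr

lemma HeatTame.iteratedDeriv_tame {F : ℂ → ℂ} (hF : HeatTame F) (n : ℕ) :
    HeatTame (iteratedDeriv n F) := by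
  induction n with
  | zero => simpa using hF
  | succ n ih => rw [iteratedDeriv_succ]; exact ih.deriv_tame

lemma HeatTame.summable_heatTerm {F : ℂ → ℂ} (hF : HeatTame F) {τ : ℂ} (hτ : ‖τ‖ < 1) (z : ℂ) :
    Summable (heatTerm τ F z) := by
  obtain ⟨u, hu, h⟩ := hF.exists_bound hτ ‖z‖
  exact Summable.of_norm_bounded hu fun k => h k τ z le_rfl le_rfl

lemma heatFlow_zero (F : ℂ → ℂ) (z : ℂ) : heatFlow 0 F z = F z := by
  rw [heatFlow, tsum_eq_single 0]
  · simp [heatTerm]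
  · intro k hk; simp [heatTerm, hk]

lemma HeatTame.continuousAt_heatFlow {F : ℂ → ℂ} (hF : HeatTame F) {p : ℂ × ℂ} (hp : ‖p.1‖ < 1) :
    ContinuousAt (fun p : ℂ × ℂ => heatFlow p.1 F p.2) p := by
  obtain ⟨q, hq1, hq2⟩ := exists_between hp
  obtain ⟨u, hu, h⟩ := hF.exists_bound hq2 (‖p.2‖ + 1)
  have hnhds : ball (0 : ℂ) q ×ˢ ball (0 : ℂ) (‖p.2‖ + 1) ∈ nhds p := by
    refine (isOpen_ball.prod isOpen_ball).mem_nhds ⟨?_, ?_⟩ <;> simp [hq1]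
  refine ContinuousOn.continuousAt (s := ball (0 : ℂ) q ×ˢ ball (0 : ℂ) (‖p.2‖ + 1)) ?_ hnhds
  refine continuousOn_tsum (fun k => ?_) hu fun k x hx => h k _ _ ?_ ?_
  · have : Continuous (iteratedDeriv (2 * k) F) :=
      (hF.iteratedDeriv_tame _).1.continuous
    unfold heatTerm
    fun_prop
  · exact (mem_ball_zero_iff.1 hx.1).le
  · exact (mem_ball_zero_iff.1 hx.2).le

lemma HeatTame.hasDerivAt_heatFlow_space {F : ℂ → ℂ} (hF : HeatTame F) {τ : ℂ} (hτ : ‖τ‖ < 1)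
    (z : ℂ) : HasDerivAt (heatFlow τ F) (heatFlow τ (deriv F) z) z := by
  obtain ⟨u, hu, h⟩ := hF.deriv_tame.exists_bound hτ (‖z‖ + 1)
  refine hasDerivAt_tsum_of_isPreconnected hu (isOpen_ball (x := (0 : ℂ)) (ε := ‖z‖ + 1))
    (convex_ball _ _).isPreconnected (g := fun k z => heatTerm τ F z k)
    (fun k y _ => ?_) (fun k y hy => h k τ y le_rfl ?_) (y₀ := z) (by simp)
    (hF.summable_heatTerm hτ z) (by simp)
  · unfold heatTerm
    rw [← iteratedDeriv_succ', iteratedDeriv_succ]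
    exact ((hF.iteratedDeriv_tame (2 * k)).1 y).hasDerivAt.const_mul _
  · exact (mem_ball_zero_iff.1 hy).le

/-- The heat equation `∂_τ (e^{-τD²/2} F) = -½ e^{-τD²/2} F''`. -/
lemma HeatTame.hasDerivAt_heatFlow_time {F : ℂ → ℂ} (hF : HeatTame F) {τ : ℂ} (hτ : ‖τ‖ < 1)
    (z : ℂ) : HasDerivAt (fun t => heatFlow t F z)
      (-(1 / 2) * heatFlow τ (deriv (deriv F)) z) τ := by
  obtain ⟨q, hq1, hq2⟩ := exists_between hτ
  have hF2 := hF.deriv_tame.deriv_tame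
  obtain ⟨u, hu, h⟩ := hF2.exists_bound hq2 ‖z‖
  -- the termwise derivative; its `(k + 1)`-st term is `-½` times the `k`-th heat term of `F''`
  let g' : ℕ → ℂ → ℂ := fun k t =>
    1 / (k.factorial : ℂ) * (k * (-t / 2) ^ (k - 1) * (-1 / 2)) * iteratedDeriv (2 * k) F z
  have hg0 : ∀ t, g' 0 t = 0 := fun t => by simp [g']
  have hg1 : ∀ k t, g' (k + 1) t = -(1 / 2) * heatTerm t (deriv (deriv F)) z k := fun k t => by
    simp only [g', heatTerm]
    rw [← iteratedDeriv_succ', ← iteratedDeriv_succ', Nat.factorial_succ]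
    have : (k.factorial : ℂ) ≠ 0 := by exact_mod_cast k.factorial_ne_zero
    have : (k + 1 : ℂ) ≠ 0 := by exact_mod_cast k.succ_ne_zero
    push_cast
    rw [show 2 * (k + 1) = 2 * k + 1 + 1 by ring]
    field_simp
  have hsum : ∑' k, g' k τ = -(1 / 2) * heatFlow τ (deriv (deriv F)) z := by
    have hs : Summable (fun k => g' (k + 1) τ) := by
      simp only [hg1]
      exact (hF2.summable_heatTerm hτ z).mul_left _
    rw [((summable_nat_add_iff (f := fun k => g' k τ) 1).1 hs).tsum_eq_zero_add, hg0, zero_add]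
    simp only [hg1, heatFlow]
    rw [tsum_mul_left]
  rw [← hsum]
  let v : ℕ → ℝ := fun k => (1 / 2) * u (k - 1)
  have hv : Summable v := (summable_nat_add_iff (f := v) 1).1 (hu.mul_left (1 / 2))
  refine hasDerivAt_tsum_of_isPreconnected hv (isOpen_ball (x := (0 : ℂ)) (ε := q))
    (convex_ball _ _).isPreconnected (g := fun k t => heatTerm t F z k)
    (fun k y _ => ?_) (fun k y hy => ?_) (y₀ := τ) (by simpa using hq1)
    (hF.summable_heatTerm hτ z) (by simpa using hq1)
  · have h1 : HasDerivAt (fun t : ℂ => (-t / 2) ^ k) (k * (-y / 2) ^ (k - 1) * (-1 / 2)) y := by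
      have := (((hasDerivAt_id y).neg.div_const 2).pow k)
      simpa using! this
    exact (h1.const_mul (1 / (k.factorial : ℂ))).mul_const (iteratedDeriv (2 * k) F z)
  · match k with
    | 0 =>
      rw [hg0, norm_zero]
      have := (norm_nonneg _).trans (h 0 y z (mem_ball_zero_iff.1 hy).le le_rfl)
      simp only [v, Nat.zero_sub]
      linarith
    | k + 1 =>
      rw [hg1, norm_mul]
      have := h k y z (mem_ball_zero_iff.1 hy).le le_rfl
      simp only [v, Nat.add_sub_cancel]
      norm_num
      linarith

/-! ### Growth criteria and joint differentiability -/

lemma summable_sq_mul_pow_div_sqrt_factorial (K : ℝ) (hK : 0 ≤ K) :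
    Summable fun m : ℕ => ((m : ℝ) + 1) ^ 2 * (K ^ m / √(m.factorial : ℝ)) := by
  obtain ⟨B, hB⟩ :=
    (FloorSemiring.tendsto_pow_div_factorial_atTop ((2 * K) ^ 2)).bddAbove_range
  have hB' : ∀ m : ℕ, (2 * K) ^ m / √(m.factorial : ℝ) ≤ √B := fun m => by
    refine Real.le_sqrt_of_sq_le ?_
    rw [div_pow, Real.sq_sqrt (by positivity), ← pow_mul, mul_comm m 2, pow_mul]
    exact hB ⟨m, rfl⟩
  -- split `Kᵐ = 2⁻ᵐ (2K)ᵐ`: the second factor stays bounded after division by `√(m!)`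
  have h1 : Summable fun m : ℕ => ((m : ℝ) + 1) ^ 2 * (1 / 2 : ℝ) ^ m := by
    have := (summable_nat_add_iff (f := fun n : ℕ => (n : ℝ) ^ 2 * (1 / 2 : ℝ) ^ n) 1).2
      (summable_pow_mul_geometric_of_norm_lt_one 2 (show ‖(1 / 2 : ℝ)‖ < 1 by norm_num))
    refine (this.mul_left 2).congr fun m => ?_
    push_cast; rw [pow_succ]; ring
  refine Summable.of_nonneg_of_le (fun m => by positivity) (fun m => ?_) (h1.mul_right √B)
  rw [mul_assoc]
  refine mul_le_mul_of_nonneg_left ?_ (by positivity)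
  calc K ^ m / √(m.factorial : ℝ) = (1 / 2) ^ m * ((2 * K) ^ m / √(m.factorial : ℝ)) := by
        rw [mul_pow, div_pow]; field_simp; simp
    _ ≤ _ := by gcongr; exact hB' m

lemma factorial_add_mul_pow_le {x : ℝ} (h0 : 0 ≤ x) (h1 : x ≤ 1) (n m : ℕ) :
    ((n + m).factorial : ℝ) * (x ^ n * (1 - x) ^ m) ≤ n.factorial * m.factorial := by
  have hc : ((n + m).choose n : ℝ) * (x ^ n * (1 - x) ^ m) ≤ 1 := by
    have h := add_pow x (1 - x) (n + m)
    rw [add_sub_cancel, one_pow] at h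
    have := Finset.single_le_sum (s := Finset.range (n + m + 1))
      (f := fun k => x ^ k * (1 - x) ^ (n + m - k) * ((n + m).choose k : ℝ))
      (fun k _ => by have : 0 ≤ 1 - x := by linarith
                     positivity) (a := n) (by simp)
    simp only [Nat.add_sub_cancel_left] at this
    rw [← h] at this
    linarith
  have hf : ((n + m).factorial : ℝ) = (n + m).choose n * (n.factorial * m.factorial) := by
    have := Nat.add_choose_mul_factorial_mul_factorial n m
    rw [Nat.add_comm n m, Nat.choose_symm_add, Nat.add_comm m n] at this
    rw [← this]; push_cast; ring
  rw [hf]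
  calc _ = ((n + m).choose n : ℝ) * (x ^ n * (1 - x) ^ m) * (n.factorial * m.factorial) := by ring
    _ ≤ 1 * (n.factorial * m.factorial) := by gcongr
    _ = _ := one_mul _

lemma iteratedDeriv_iteratedDeriv (m n : ℕ) (F : ℂ → ℂ) :
    iteratedDeriv m (iteratedDeriv n F) = iteratedDeriv (n + m) F := by
  rw [iteratedDeriv_eq_iterate, iteratedDeriv_eq_iterate, iteratedDeriv_eq_iterate, add_comm,
    Function.iterate_add_apply]

/-- Polynomially bounded coefficients with respect to the basis `zⁿ / √(n!)` suffice for
`HeatTame`. Taylor expansion moves the bound from `0` to `z`, the factor `√((n + m)!)` being split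
by means of `binom(n + m, n) ρⁿ (1 - ρ)ᵐ ≤ 1`. -/
lemma heatTame_of_norm_iteratedDeriv_zero_le {F : ℂ → ℂ} (hF : Differentiable ℂ F) {C : ℝ}
    (hC : ∀ n : ℕ, ‖iteratedDeriv n F 0‖ ≤ C * ((n : ℝ) + 1) ^ 2 * √(n.factorial : ℝ)) :
    HeatTame F := by
  refine ⟨hF, fun ρ hρ0 hρ1 R => ?_⟩
  have hC0 : 0 ≤ C := by
    have := (norm_nonneg _).trans (hC 0)
    simpa using this
  -- with `ρ = σ²` one factor `σⁿ` pays for the binomial coefficient, the other for `(n + 1)²`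
  set σ := √ρ
  set s := √(1 - ρ)
  have hσ0 : 0 < σ := Real.sqrt_pos.2 hρ0
  have hs0 : 0 < s := Real.sqrt_pos.2 (by linarith)
  have hσ1 : σ < 1 := by rw [Real.sqrt_lt' one_pos]; linarith
  have hσ2 : σ ^ 2 = ρ := Real.sq_sqrt hρ0.le
  have hs2 : s ^ 2 = 1 - ρ := Real.sq_sqrt (by linarith)
  have key : ∀ n m : ℕ, √((n + m).factorial : ℝ) * (σ ^ n * s ^ m) ≤
      √(n.factorial : ℝ) * √(m.factorial : ℝ) := fun n m => by
    rw [← Real.sqrt_mul (by positivity)]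
    refine Real.le_sqrt_of_sq_le ?_
    rw [mul_pow, Real.sq_sqrt (by positivity), mul_pow, ← pow_mul, ← pow_mul, mul_comm n 2,
      mul_comm m 2, pow_mul, pow_mul, hσ2, hs2]
    exact factorial_add_mul_pow_le hρ0.le hρ1.le n m
  obtain ⟨M, hM⟩ : ∃ M : ℝ, ∀ n : ℕ, ((n : ℝ) + 1) ^ 2 * σ ^ n ≤ M := by
    have h := (tendsto_pow_const_mul_const_pow_of_abs_lt_one 2
      (show |σ| < 1 by rwa [abs_of_pos hσ0])).bddAbove_range
    obtain ⟨M, hM⟩ := h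
    refine ⟨M / σ, fun n => ?_⟩
    rw [le_div_iff₀ hσ0]
    have := hM ⟨n + 1, rfl⟩
    push_cast at this
    rw [mul_assoc, ← pow_succ]
    exact this
  have hw := summable_sq_mul_pow_div_sqrt_factorial (|R| / s) (by positivity)
  set w : ℕ → ℝ := fun m => ((m : ℝ) + 1) ^ 2 * ((|R| / s) ^ m / √(m.factorial : ℝ)) with hwdef
  refine ⟨C * M * ∑' m, w m, fun n z hz => ?_⟩
  have hd : Differentiable ℂ (iteratedDeriv n F) :=
    hF.contDiff.differentiable_iteratedDeriv (n := ⊤) n (by simp)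
  have hsum := Complex.hasSum_taylorSeries_of_entire hd 0 z
  simp only [iteratedDeriv_iteratedDeriv] at hsum
  have hbound : ∀ m : ℕ, ‖((m.factorial : ℂ)⁻¹ • (z - 0) ^ m • iteratedDeriv (n + m) F 0)‖ ≤
      (C * M * √(n.factorial : ℝ) / ρ ^ n) * w m := fun m => by
    have hfm : (0 : ℝ) < m.factorial := by exact_mod_cast m.factorial_pos
    have hz' : ‖z‖ ≤ |R| := hz.trans (le_abs_self R)
    have e1 : (((n + m : ℕ) : ℝ) + 1) ^ 2 ≤ ((n : ℝ) + 1) ^ 2 * ((m : ℝ) + 1) ^ 2 := by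
      rw [← mul_pow]
      gcongr
      push_cast
      nlinarith [(Nat.cast_nonneg n : (0 : ℝ) ≤ n), (Nat.cast_nonneg m : (0 : ℝ) ≤ m)]
    have hsq : √(m.factorial : ℝ) * √(m.factorial : ℝ) = m.factorial :=
      Real.mul_self_sqrt hfm.le
    have hsqpos : 0 < √(m.factorial : ℝ) := Real.sqrt_pos.2 hfm
    rw [norm_smul, norm_smul, norm_inv, norm_pow, sub_zero, Complex.norm_natCast, ← div_eq_inv_mul]
    calc ‖z‖ ^ m * ‖iteratedDeriv (n + m) F 0‖ / m.factorial
        ≤ |R| ^ m * (C * (((n : ℝ) + 1) ^ 2 * ((m : ℝ) + 1) ^ 2) *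
            (√(n.factorial : ℝ) * √(m.factorial : ℝ) / (σ ^ n * s ^ m))) / m.factorial := by
          gcongr
          refine (hC (n + m)).trans ?_
          gcongr
          rw [le_div_iff₀ (by positivity)]
          exact key n m
      _ = C * (((n : ℝ) + 1) ^ 2 * σ ^ n) * √(n.factorial : ℝ) / ρ ^ n * w m := by
          rw [hwdef, ← hσ2]
          simp only [div_pow]
          nth_rewrite 2 [← hsq]
          field_simp
          ring
      _ ≤ _ := by
          have : 0 ≤ w m := by positivity
          gcongr
          exact hM n
  have h1 : ‖iteratedDeriv n F z‖ ≤ (C * M * √(n.factorial : ℝ) / ρ ^ n) * ∑' m, w m := by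
    rw [← hsum.tsum_eq]
    refine (tsum_of_norm_bounded (hw.mul_left _).hasSum hbound).trans_eq ?_
    rw [tsum_mul_left]
  calc ‖iteratedDeriv n F z‖ * ρ ^ n
      ≤ ((C * M * √(n.factorial : ℝ) / ρ ^ n) * ∑' m, w m) * ρ ^ n := by gcongr
    _ = _ := by field_simp

lemma HeatTame.add_const_mul {F H : ℂ → ℂ} (hF : HeatTame F) (hH : HeatTame H) (c : ℂ) :
    HeatTame (fun z => F z + c * H z) := by
  refine ⟨hF.1.add (hH.1.const_mul c), fun ρ h0 h1 R => ?_⟩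
  obtain ⟨C, hC⟩ := hF.2 ρ h0 h1 R
  obtain ⟨D, hD⟩ := hH.2 ρ h0 h1 R
  refine ⟨C + ‖c‖ * D, fun n z hz => ?_⟩
  rw [iteratedDeriv_fun_add (hF.1.contDiff.contDiffAt) ((hH.1.const_mul c).contDiff.contDiffAt),
    iteratedDeriv_const_mul_field]
  calc _ ≤ (‖iteratedDeriv n F z‖ + ‖c‖ * ‖iteratedDeriv n H z‖) * ρ ^ n := by
        gcongr
        exact (norm_add_le _ _).trans_eq (by rw [norm_mul])
    _ = ‖iteratedDeriv n F z‖ * ρ ^ n + ‖c‖ * (‖iteratedDeriv n H z‖ * ρ ^ n) := by ring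
    _ ≤ C * √(n.factorial : ℝ) + ‖c‖ * (D * √(n.factorial : ℝ)) := by
        exact add_le_add (hC n z hz) (mul_le_mul_of_nonneg_left (hD n z hz) (norm_nonneg c))
    _ = _ := by ring

lemma HeatTame.heatFlow_add_const_mul {F H : ℂ → ℂ} (hF : HeatTame F) (hH : HeatTame H) (c : ℂ)
    {τ : ℂ} (hτ : ‖τ‖ < 1) (z : ℂ) :
    heatFlow τ (fun z => F z + c * H z) z = heatFlow τ F z + c * heatFlow τ H z := by
  unfold heatFlow
  rw [← tsum_mul_left, ← (hF.summable_heatTerm hτ z).tsum_add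
    ((hH.summable_heatTerm hτ z).mul_left c)]
  congr 1; ext k
  unfold heatTerm
  rw [iteratedDeriv_fun_add (hF.1.contDiff.contDiffAt) ((hH.1.const_mul c).contDiff.contDiffAt),
    iteratedDeriv_const_mul_field]
  ring

lemma HeatTame.eventually_hasFDerivAt {F : ℂ → ℂ} (hF : HeatTame F) {p : ℂ × ℂ} (hp : ‖p.1‖ < 1) :
    (∀ᶠ v in nhds p, HasFDerivAt (fun t => heatFlow t F v.2)
      (ContinuousLinearMap.toSpanSingleton ℂ
        (-(1 / 2) * heatFlow v.1 (deriv (deriv F)) v.2)) v.1) ∧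
    (∀ᶠ v in nhds p, HasFDerivAt (fun z => heatFlow v.1 F z)
      (ContinuousLinearMap.toSpanSingleton ℂ (heatFlow v.1 (deriv F) v.2)) v.2) := by
  have h : ∀ᶠ v : ℂ × ℂ in nhds p, ‖v.1‖ < 1 :=
    (continuous_fst.norm.continuousAt (x := p)).eventually (gt_mem_nhds hp)
  exact ⟨h.mono fun v hv => (hF.hasDerivAt_heatFlow_time hv v.2).hasFDerivAt,
    h.mono fun v hv => (hF.hasDerivAt_heatFlow_space hv v.2).hasFDerivAt⟩

lemma HeatTame.continuousAt_partials {F : ℂ → ℂ} (hF : HeatTame F) {p : ℂ × ℂ} (hp : ‖p.1‖ < 1) :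
    ContinuousAt (fun v : ℂ × ℂ => ContinuousLinearMap.toSpanSingleton ℂ
        (-(1 / 2) * heatFlow v.1 (deriv (deriv F)) v.2)) p ∧
    ContinuousAt (fun v : ℂ × ℂ => ContinuousLinearMap.toSpanSingleton ℂ
        (heatFlow v.1 (deriv F) v.2)) p := by
  have hc : Continuous (fun c : ℂ => ContinuousLinearMap.toSpanSingleton ℂ c) :=
    (ContinuousLinearMap.toSpanSingletonLE ℂ ℂ ℂ).continuous_of_finiteDimensional
  exact ⟨hc.continuousAt.comp (continuousAt_const.mul
      (hF.deriv_tame.deriv_tame.continuousAt_heatFlow hp)),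
    hc.continuousAt.comp (hF.deriv_tame.continuousAt_heatFlow hp)⟩

/-- The chain rule along a moving point; both partial derivatives of `(τ, z) ↦ e^{-τD²/2} F (z)`
are jointly continuous, hence the function is jointly differentiable. -/
lemma HeatTame.hasDerivAt_heatFlow_comp {F : ℂ → ℂ} (hF : HeatTame F) {ζ : ℂ → ℂ} {ζ' τ : ℂ}
    (hτ : ‖τ‖ < 1) (hζ : HasDerivAt ζ ζ' τ) :
    HasDerivAt (fun t => heatFlow t F (ζ t))
      (-(1 / 2) * heatFlow τ (deriv (deriv F)) (ζ τ) + ζ' * heatFlow τ (deriv F) (ζ τ)) τ := by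
  have hp : ‖((τ, ζ τ) : ℂ × ℂ).1‖ < 1 := hτ
  have h := (hasStrictFDerivAt_uncurry_coprod (f := fun t z => heatFlow t F z)
    (f₁ := fun t z => ContinuousLinearMap.toSpanSingleton ℂ
        (-(1 / 2) * heatFlow t (deriv (deriv F)) z))
    (f₂ := fun t z => ContinuousLinearMap.toSpanSingleton ℂ (heatFlow t (deriv F) z))
    (hF.eventually_hasFDerivAt hp).1 (hF.eventually_hasFDerivAt hp).2
    (hF.continuousAt_partials hp).1 (hF.continuousAt_partials hp).2).hasFDerivAt
  have h2 : HasDerivAt (fun t => (t, ζ t)) (1, ζ') τ := (hasDerivAt_id τ).prodMk hζ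
  have h3 := h.comp_hasDerivAt τ h2
  refine h3.congr_deriv ?_
  simp [Function.HasUncurry.uncurry]

/-! ### Fock-space translations and existence of zero paths -/

/-- The translation `F ↦ exp(ā z - |a|²/2) F(z - a)` of the Fock space, with `|a|²` written `ā a`.
-/
noncomputable def fockShift (a : ℂ) (F : ℂ → ℂ) : ℂ → ℂ := fun z =>
  Complex.exp (starRingEnd ℂ a * z - starRingEnd ℂ a * a / 2) * F (z - a)

lemma fockShift_neg_fockShift (a : ℂ) (F : ℂ → ℂ) : fockShift (-a) (fockShift a F) = F := by
  funext z
  simp only [fockShift]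
  rw [← mul_assoc, ← Complex.exp_add]
  simp only [map_neg, sub_neg_eq_add, add_sub_cancel_right]
  rw [show -(starRingEnd ℂ) a * z - -(starRingEnd ℂ) a * -a / 2 +
    ((starRingEnd ℂ) a * (z + a) - (starRingEnd ℂ) a * a / 2) = 0 by ring, Complex.exp_zero,
    one_mul]

lemma fockShift_fockShift_neg (a : ℂ) (F : ℂ → ℂ) : fockShift a (fockShift (-a) F) = F := by
  simpa using fockShift_neg_fockShift (-a) F

lemma differentiable_fockShift (a : ℂ) {F : ℂ → ℂ} (hF : Differentiable ℂ F) :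
    Differentiable ℂ (fockShift a F) := by
  unfold fockShift
  have : Differentiable ℂ (fun z => F (z - a)) := hF.comp (differentiable_id.sub_const a)
  fun_prop

/-- The operator `D + b`, the conjugate of `D` by multiplication with `e^{bz}`. -/
noncomputable def twistedDeriv (b : ℂ) (F : ℂ → ℂ) : ℂ → ℂ := fun z => deriv F z + b * F z

lemma HeatTame.twistedDeriv_tame {F : ℂ → ℂ} (hF : HeatTame F) (b : ℂ) :
    HeatTame (twistedDeriv b F) := hF.deriv_tame.add_const_mul hF b

lemma HeatTame.deriv_twistedDeriv {F : ℂ → ℂ} (hF : HeatTame F) (b : ℂ) :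
    deriv (twistedDeriv b F) = twistedDeriv b (deriv F) := by
  funext z
  exact ((hF.deriv_tame.1 z).hasDerivAt.add ((hF.1 z).hasDerivAt.const_mul b)).deriv

lemma HeatTame.heatFlow_twistedDeriv {F : ℂ → ℂ} (hF : HeatTame F) (b : ℂ) {τ : ℂ} (hτ : ‖τ‖ < 1)
    (z : ℂ) : heatFlow τ (twistedDeriv b F) z = heatFlow τ (deriv F) z + b * heatFlow τ F z :=
  hF.deriv_tame.heatFlow_add_const_mul hF b hτ z

lemma deriv_fockShift (a : ℂ) {F : ℂ → ℂ} (hF : Differentiable ℂ F) :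
    deriv (fockShift a F) = fockShift a (twistedDeriv (starRingEnd ℂ a) F) := by
  funext z
  have h1 : HasDerivAt (fun z => Complex.exp (starRingEnd ℂ a * z - starRingEnd ℂ a * a / 2))
      (Complex.exp (starRingEnd ℂ a * z - starRingEnd ℂ a * a / 2) * (starRingEnd ℂ a)) z := by
    have := (((hasDerivAt_id z).const_mul (starRingEnd ℂ a)).sub_const
      (starRingEnd ℂ a * a / 2)).cexp
    simpa using this
  have h2 : HasDerivAt (fun z => F (z - a)) (deriv F (z - a)) z := by
    simpa using HasDerivAt.comp_sub_const z a (hF (z - a)).hasDerivAt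
  refine (h1.mul h2).deriv.trans ?_
  simp only [fockShift, twistedDeriv]
  ring

/-- The closed form, as a function of `τ`, of the heat flow of `fockShift a F` at `z`: the initial
datum `e^{āz}` evolves to `e^{āz - τā²/2}`, and the argument of `F` drifts by `τ ā`. -/
noncomputable def shiftedHeatFlow (a z : ℂ) (F : ℂ → ℂ) (τ : ℂ) : ℂ :=
  Complex.exp (starRingEnd ℂ a * z - starRingEnd ℂ a * a / 2 - τ * (starRingEnd ℂ a) ^ 2 / 2) *
    heatFlow τ F (z - a - τ * starRingEnd ℂ a)

lemma HeatTame.hasDerivAt_shiftedHeatFlow {F : ℂ → ℂ} (hF : HeatTame F) (a z : ℂ) {τ : ℂ}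
    (hτ : ‖τ‖ < 1) : HasDerivAt (shiftedHeatFlow a z F)
      (-(1 / 2) * shiftedHeatFlow a z
        (twistedDeriv (starRingEnd ℂ a) (twistedDeriv (starRingEnd ℂ a) F)) τ) τ := by
  set b := starRingEnd ℂ a
  have h1 : HasDerivAt (fun t => Complex.exp (b * z - b * a / 2 - t * b ^ 2 / 2))
      (Complex.exp (b * z - b * a / 2 - τ * b ^ 2 / 2) * (-(b ^ 2 / 2))) τ := by
    have := ((((hasDerivAt_id τ).mul_const (b ^ 2)).div_const 2).const_sub
      (b * z - b * a / 2)).cexp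
    simpa using this
  have h2 : HasDerivAt (fun t => z - a - t * b) (-b) τ := by
    simpa using ((hasDerivAt_id τ).mul_const b).const_sub (z - a)
  refine (h1.mul (hF.hasDerivAt_heatFlow_comp hτ h2)).congr_deriv ?_
  unfold shiftedHeatFlow
  rw [(hF.twistedDeriv_tame b).heatFlow_twistedDeriv b hτ, hF.deriv_twistedDeriv,
    hF.deriv_tame.heatFlow_twistedDeriv b hτ, hF.heatFlow_twistedDeriv b hτ]
  ring

/-- Differentiating in `τ` replaces `F` by `-½ (D + ā)² F`, which is what two derivatives in `z`
do to `fockShift a F`. Hence the Taylor coefficients in `τ` of the closed form are the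
coefficients of the heat-flow series of `fockShift a F`. -/
lemma HeatTame.iteratedDeriv_shiftedHeatFlow (a z : ℂ) (k : ℕ) :
    ∀ {F : ℂ → ℂ}, HeatTame F → iteratedDeriv k (shiftedHeatFlow a z F) 0 =
      (-(1 / 2)) ^ k * iteratedDeriv (2 * k) (fockShift a F) z := by
  induction k with
  | zero =>
    intro F hF
    simp [shiftedHeatFlow, heatFlow_zero, fockShift]
  | succ k ih =>
    intro F hF
    set b := starRingEnd ℂ a
    have hF2 := (hF.twistedDeriv_tame b).twistedDeriv_tame b
    have h : deriv (shiftedHeatFlow a z F) =ᶠ[nhds 0] fun t =>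
        -(1 / 2) * shiftedHeatFlow a z (twistedDeriv b (twistedDeriv b F)) t := by
      filter_upwards [ball_mem_nhds (0 : ℂ) one_pos] with t ht
      exact (hF.hasDerivAt_shiftedHeatFlow a z (mem_ball_zero_iff.1 ht)).deriv
    rw [iteratedDeriv_succ', h.iteratedDeriv_eq, iteratedDeriv_const_mul_field, ih hF2,
      show 2 * (k + 1) = 2 * k + 1 + 1 by ring, iteratedDeriv_succ', iteratedDeriv_succ',
      deriv_fockShift a hF.1, deriv_fockShift a (hF.twistedDeriv_tame b).1]
    ring

/-- The heat-flow series of `fockShift a F` at `z` is the Taylor series in `τ` of a function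
holomorphic on the unit disk, so it converges there; no growth bound on `fockShift a F` is needed.
-/
lemma HeatTame.hasSum_heatTerm_fockShift {F : ℂ → ℂ} (hF : HeatTame F) (a z : ℂ) {τ : ℂ}
    (hτ : ‖τ‖ < 1) :
    HasSum (heatTerm τ (fockShift a F) z) (shiftedHeatFlow a z F τ) := by
  have hd : DifferentiableOn ℂ (shiftedHeatFlow a z F) (ball 0 1) := fun t ht =>
    (hF.hasDerivAt_shiftedHeatFlow a z
      (mem_ball_zero_iff.1 ht)).differentiableAt.differentiableWithinAt
  have h := Complex.hasSum_taylorSeries_on_ball hd (mem_ball_zero_iff.2 hτ)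
  refine h.congr_fun fun k => ?_
  simp only [sub_zero, smul_eq_mul, HeatTame.iteratedDeriv_shiftedHeatFlow a z k hF, heatTerm]
  rw [show -τ / 2 = τ * (-(1 / 2)) by ring, mul_pow]
  ring

/-- Translating `F` by `a` in Fock space moves the zero path to `a + τ ā + ζ(τ)`. -/
lemma HeatTame.isHeatZeroPath_fockShift_iff {F : ℂ → ℂ} (hF : HeatTame F) (a : ℂ) {r : ℝ}
    (hr : r ≤ 1) (ζ : ℂ → ℂ) :
    IsHeatZeroPath (fockShift a F) a r ζ ↔
      IsHeatZeroPath F 0 r (fun τ => ζ τ - a - τ * starRingEnd ℂ a) := by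
  unfold IsHeatZeroPath
  refine and_congr ⟨fun h => ?_, fun h => ?_⟩ (and_congr ?_ ?_)
  · exact (h.sub_const a).sub (by fun_prop)
  · have : ζ = fun τ => (ζ τ - a - τ * starRingEnd ℂ a) + (a + τ * starRingEnd ℂ a) := by
      funext τ; ring
    rw [this]
    exact h.add (by fun_prop)
  · simp [sub_eq_zero]
  · refine forall₂_congr fun τ hτ => ?_
    have hτ1 : ‖τ‖ < 1 := (mem_ball_zero_iff.1 hτ).trans_le hr
    have h := hF.hasSum_heatTerm_fockShift a (ζ τ) hτ1
    refine and_congr ⟨fun _ => hF.summable_heatTerm hτ1 _, fun _ => h.summable⟩ ?_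
    rw [heatFlow, h.tsum_eq, shiftedHeatFlow]
    simp [Complex.exp_ne_zero]

/-- The implicit function theorem at `(τ, z) = (0, 0)`. -/
lemma HeatTame.exists_isHeatZeroPath {F : ℂ → ℂ} (hF : HeatTame F) (h0 : F 0 = 0)
    (h1 : deriv F 0 ≠ 0) : ∃ r : ℝ, 0 < r ∧ ∃ ζ : ℂ → ℂ, IsHeatZeroPath F 0 r ζ := by
  have inv : ∀ c : ℂ, c ≠ 0 → (ContinuousLinearMap.toSpanSingleton ℂ c).IsInvertible := by
    intro c hc
    refine ContinuousLinearMap.IsInvertible.of_inverse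
      (g := ContinuousLinearMap.toSpanSingleton ℂ c⁻¹) ?_ ?_ <;> ext <;> simp [hc]
  let f₁ : ℂ → ℂ → ℂ →L[ℂ] ℂ := fun t z => ContinuousLinearMap.toSpanSingleton ℂ
        (-(1 / 2) * heatFlow t (deriv (deriv F)) z)
  let f₂ : ℂ → ℂ → ℂ →L[ℂ] ℂ := fun t z =>
    ContinuousLinearMap.toSpanSingleton ℂ (heatFlow t (deriv F) z)
  have key : ∀ u : ℂ × ℂ, ‖u.1‖ < 1 → heatFlow u.1 (deriv F) u.2 ≠ 0 →
      ∃ ψ : ℂ → ℂ, (∀ᶠ x in nhds u.1, heatFlow x F (ψ x) = heatFlow u.1 F u.2) ∧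
        (∀ᶠ v in nhds u, heatFlow v.1 F v.2 = heatFlow u.1 F u.2 ↔ ψ v.1 = v.2) ∧
        DifferentiableAt ℂ ψ u.1 ∧ Filter.Tendsto ψ (nhds u.1) (nhds u.2) := by
    intro u hu hu1
    have A := hF.eventually_hasFDerivAt hu
    have B := hF.continuousAt_partials hu
    have C : (f₂ u.1 u.2).IsInvertible := inv _ hu1
    exact ⟨implicitFunctionOfBivariate (f := fun t z => heatFlow t F z) (f₁ := f₁) (f₂ := f₂)
        A.1 A.2 B.1 B.2 C,
      eventually_apply_implicitFunctionOfBivariate (f := fun t z => heatFlow t F z) (f₁ := f₁)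
        (f₂ := f₂) A.1 A.2 B.1 B.2 C,
      eventually_apply_eq_iff_implicitFunctionOfBivariate (f := fun t z => heatFlow t F z)
        (f₁ := f₁) (f₂ := f₂) A.1 A.2 B.1 B.2 C,
      (hasStrictFDerivAt_implicitFunctionOfBivariate (f := fun t z => heatFlow t F z)
        (f₁ := f₁) (f₂ := f₂) A.1 A.2 B.1 B.2 C).hasFDerivAt.differentiableAt,
      tendsto_implicitFunctionOfBivariate (f := fun t z => heatFlow t F z)
        (f₁ := f₁) (f₂ := f₂) A.1 A.2 B.1 B.2 C⟩
  have hu0 : ‖((0, 0) : ℂ × ℂ).1‖ < 1 := by simp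
  obtain ⟨ψ, hψ1, hψ2, hψ3, hψ4⟩ := key (0, 0) hu0 (by simpa [heatFlow_zero] using h1)
  simp only [heatFlow_zero, h0] at hψ1 hψ2 hψ3 hψ4
  have hψ0 : ψ 0 = 0 := by
    have := hψ2.self_of_nhds
    simpa [heatFlow_zero, h0] using this
  have hcont : Filter.Tendsto (fun x => (x, ψ x)) (nhds 0) (nhds ((0, 0) : ℂ × ℂ)) :=
    Filter.tendsto_id.prodMk_nhds hψ4
  have hne : ∀ᶠ x in nhds (0 : ℂ), heatFlow x (deriv F) (ψ x) ≠ 0 := by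
    have := (hF.deriv_tame.continuousAt_heatFlow hu0).tendsto.comp hcont
    refine this.eventually_ne ?_
    simpa [heatFlow_zero] using h1
  -- near each point of its graph, `ψ` agrees with the implicit function based at that point
  have hdiff : ∀ᶠ x in nhds (0 : ℂ), DifferentiableAt ℂ ψ x := by
    filter_upwards [hne, hcont.eventually hψ2.eventually_nhds, hψ1,
      ball_mem_nhds (0 : ℂ) one_pos] with x hx1 hx2 hx3 hx4
    obtain ⟨φ, hφ1, -, hφ3, hφ4⟩ := key (x, ψ x) (mem_ball_zero_iff.1 hx4) hx1
    have hφx : φ x = ψ x := by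
      have := hφ3.continuousAt.tendsto
      exact tendsto_nhds_unique this hφ4
    refine hφ3.congr_of_eventuallyEq ?_
    have hc : Filter.Tendsto (fun y => (y, φ y)) (nhds x) (nhds ((x, ψ x) : ℂ × ℂ)) :=
      Filter.tendsto_id.prodMk_nhds hφ4
    filter_upwards [hφ1, hc.eventually hx2] with y hy1 hy2
    simp only [hx3] at hy1
    exact hy2.1 hy1
  obtain ⟨r, hr, hball⟩ := Metric.eventually_nhds_iff_ball.1
    (hdiff.and (hψ1.and (ball_mem_nhds (0 : ℂ) one_pos)))
  refine ⟨r, hr, ψ, fun x hx => (hball x hx).1.differentiableWithinAt, hψ0, fun τ hτ => ?_⟩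
  obtain ⟨-, h2, h3⟩ := hball τ hτ
  exact ⟨hF.summable_heatTerm (mem_ball_zero_iff.1 h3) _, h2⟩

/-! ### Taylor coefficients of zero paths -/

open MvPolynomial in
/-- The time derivative, along a zero path, of polynomials in the symbols `X (some j)`, standing
for the `j`-th spatial derivative of the heat flow at the path, and `X none`, standing for the
inverse of the first one. It encodes `ζ' = ½ H'' / H'` together with the heat equation. -/
noncomputable def heatJetDeriv :
    Derivation ℂ (MvPolynomial (Option ℕ) ℂ) (MvPolynomial (Option ℕ) ℂ) :=
  mkDerivation ℂ fun i => match i with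
    | some j => C (-(1 / 2)) * X (some (j + 2)) +
        C (1 / 2) * X (some 2) * X none * X (some (j + 1))
    | none => -(X none ^ 2 * (C (-(1 / 2)) * X (some 3) +
        C (1 / 2) * X (some 2) * X none * X (some 2)))

/-- The values of the symbols of `heatJetDeriv` at time `τ` and position `z`. -/
noncomputable def heatJet (F : ℂ → ℂ) (τ z : ℂ) : Option ℕ → ℂ
  | some j => heatFlow τ (iteratedDeriv j F) z
  | none => (heatFlow τ (deriv F) z)⁻¹

/-- The velocity `½ H'' / H'` of a zero of the heat flow. -/
noncomputable def pathVelocity : MvPolynomial (Option ℕ) ℂ :=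
  MvPolynomial.C (1 / 2) * MvPolynomial.X (some 2) * MvPolynomial.X none

lemma HeatTame.hasDerivAt_isHeatZeroPath {F : ℂ → ℂ} (hF : HeatTame F) {a : ℂ} {r : ℝ} {ζ : ℂ → ℂ}
    (hζ : IsHeatZeroPath F a r ζ) {τ : ℂ} (hτ : τ ∈ ball (0 : ℂ) (min r 1))
    (h1 : heatFlow τ (deriv F) (ζ τ) ≠ 0) :
    HasDerivAt ζ (MvPolynomial.aeval (heatJet F τ (ζ τ)) pathVelocity) τ := by
  have hτr : τ ∈ ball (0 : ℂ) r := ball_subset_ball (min_le_left _ _) hτ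
  have hτ1 : ‖τ‖ < 1 := mem_ball_zero_iff.1 (ball_subset_ball (min_le_right _ _) hτ)
  have hd : HasDerivAt ζ (deriv ζ τ) τ :=
    ((hζ.1 τ hτr).differentiableAt (isOpen_ball.mem_nhds hτr)).hasDerivAt
  have h2 := hF.hasDerivAt_heatFlow_comp hτ1 hd
  have h3 : (fun t => heatFlow t F (ζ t)) =ᶠ[nhds τ] fun _ => 0 := by
    filter_upwards [isOpen_ball.mem_nhds hτr] with t ht
    exact (hζ.2.2 t ht).2
  have h4 := h2.unique ((hasDerivAt_const τ (0 : ℂ)).congr_of_eventuallyEq h3)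
  refine hd.congr_deriv ?_
  simp only [pathVelocity, heatJet, map_mul, MvPolynomial.aeval_X, MvPolynomial.aeval_C]
  rw [iteratedDeriv_succ, iteratedDeriv_one]
  simp only [Algebra.algebraMap_self, RingHom.id_apply]
  rw [← div_eq_mul_inv, eq_div_iff h1]
  linear_combination h4

lemma HeatTame.hasDerivAt_aeval_heatJet {F : ℂ → ℂ} (hF : HeatTame F) {a : ℂ} {r : ℝ} {ζ : ℂ → ℂ}
    (hζ : IsHeatZeroPath F a r ζ) {τ : ℂ} (hτ : τ ∈ ball (0 : ℂ) (min r 1))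
    (h1 : heatFlow τ (deriv F) (ζ τ) ≠ 0) (p : MvPolynomial (Option ℕ) ℂ) :
    HasDerivAt (fun t => MvPolynomial.aeval (heatJet F t (ζ t)) p)
      (MvPolynomial.aeval (heatJet F τ (ζ τ)) (heatJetDeriv p)) τ := by
  have hτ1 : ‖τ‖ < 1 := mem_ball_zero_iff.1 (ball_subset_ball (min_le_right _ _) hτ)
  have hd := hF.hasDerivAt_isHeatZeroPath hζ hτ h1
  have hX : ∀ j : ℕ, HasDerivAt (fun t => heatFlow t (iteratedDeriv j F) (ζ t))
      (MvPolynomial.aeval (heatJet F τ (ζ τ)) (heatJetDeriv (MvPolynomial.X (some j)))) τ := by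
    intro j
    refine ((hF.iteratedDeriv_tame j).hasDerivAt_heatFlow_comp hτ1 hd).congr_deriv ?_
    simp [heatJetDeriv, MvPolynomial.mkDerivation_X, pathVelocity, heatJet,
      iteratedDeriv_succ]
  induction p using MvPolynomial.induction_on with
  | C c => simpa using hasDerivAt_const τ c
  | add p q hp hq =>
    simp only [map_add]
    exact hp.add hq
  | mul_X p i hp =>
    have hi : HasDerivAt (fun t => MvPolynomial.aeval (heatJet F t (ζ t))
        (MvPolynomial.X i : MvPolynomial (Option ℕ) ℂ))
        (MvPolynomial.aeval (heatJet F τ (ζ τ)) (heatJetDeriv (MvPolynomial.X i))) τ := by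
      match i with
      | some j => simpa [heatJet] using hX j
      | none =>
        have h := (hX 1).inv (by simpa using h1)
        simp only [iteratedDeriv_one] at h
        simp only [MvPolynomial.aeval_X, heatJet]
        refine h.congr_deriv ?_
        simp [heatJetDeriv, MvPolynomial.mkDerivation_X, heatJet]
        ring
    simp only [map_mul, Derivation.leibniz, map_add, smul_eq_mul]
    exact (hp.mul hi).congr_deriv (by ring)

/-- The values of the symbols of `heatJetDeriv` at time `0` and position `0`. -/
noncomputable def jetAtZero (F : ℂ → ℂ) : Option ℕ → ℂ
  | some j => iteratedDeriv j F 0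
  | none => (deriv F 0)⁻¹

lemma heatJet_zero (F : ℂ → ℂ) : heatJet F 0 0 = jetAtZero F := by
  funext i
  match i with
  | some j => exact heatFlow_zero _ _
  | none => simp [heatJet, jetAtZero, heatFlow_zero]

/-- The Taylor coefficients at `0` of the zero path of `F` that starts at a simple zero `0`:
explicit polynomials in the derivatives of `F` at `0` and in `1 / F'(0)`. -/
noncomputable def pathCoeff (F : ℂ → ℂ) : ℕ → ℂ
  | 0 => 0
  | n + 1 => MvPolynomial.aeval (jetAtZero F) (heatJetDeriv^[n] pathVelocity) /
      ((n + 1).factorial : ℂ)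

lemma IsHeatZeroPath.eventually_deriv_ne_zero {F : ℂ → ℂ} (hF : HeatTame F) (h1 : deriv F 0 ≠ 0)
    {r : ℝ} (hr : 0 < r) {ζ : ℂ → ℂ} (hζ : IsHeatZeroPath F 0 r ζ) :
    ∀ᶠ τ in nhds (0 : ℂ), heatFlow τ (deriv F) (ζ τ) ≠ 0 := by
  have hc : Filter.Tendsto (fun x => (x, ζ x)) (nhds 0) (nhds ((0, 0) : ℂ × ℂ)) := by
    have : ContinuousAt ζ 0 :=
      ((hζ.1 0 (mem_ball_self hr)).differentiableAt (ball_mem_nhds 0 hr)).continuousAt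
    have h := this.tendsto
    rw [hζ.2.1] at h
    exact Filter.tendsto_id.prodMk_nhds h
  refine ((hF.deriv_tame.continuousAt_heatFlow (p := (0, 0)) (by simp)).tendsto.comp
    hc).eventually_ne ?_
  simpa [heatFlow_zero] using h1

/-- A zero path starting at the simple zero `0` has prescribed Taylor coefficients; this gives
both its uniqueness and its measurable dependence on `F`. -/
lemma IsHeatZeroPath.taylorSeq_eq {F : ℂ → ℂ} (hF : HeatTame F) (h1 : deriv F 0 ≠ 0)
    {r : ℝ} (hr : 0 < r) {ζ : ℂ → ℂ} (hζ : IsHeatZeroPath F 0 r ζ) :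
    taylorSeq ζ = pathCoeff F := by
  have hev := hζ.eventually_deriv_ne_zero hF h1 hr
  have hball : ∀ᶠ τ in nhds (0 : ℂ), τ ∈ ball (0 : ℂ) (min r 1) :=
    ball_mem_nhds 0 (lt_min hr one_pos)
  have hiter : ∀ (n : ℕ) (p : MvPolynomial (Option ℕ) ℂ),
      iteratedDeriv n (fun t => MvPolynomial.aeval (heatJet F t (ζ t)) p) 0 =
        MvPolynomial.aeval (jetAtZero F) (heatJetDeriv^[n] p) := by
    intro n
    induction n with
    | zero => intro p; simp [hζ.2.1, heatJet_zero]
    | succ n ih =>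
      intro p
      have h : deriv (fun t => MvPolynomial.aeval (heatJet F t (ζ t)) p) =ᶠ[nhds 0]
          fun t => MvPolynomial.aeval (heatJet F t (ζ t)) (heatJetDeriv p) := by
        filter_upwards [hev, hball] with t ht ht'
        exact (hF.hasDerivAt_aeval_heatJet hζ ht' ht p).deriv
      rw [iteratedDeriv_succ', h.iteratedDeriv_eq, ih, Function.iterate_succ_apply]
  funext n
  match n with
  | 0 => simp [taylorSeq, pathCoeff, hζ.2.1]
  | n + 1 =>
    have h : deriv ζ =ᶠ[nhds 0] fun t => MvPolynomial.aeval (heatJet F t (ζ t)) pathVelocity := by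
      filter_upwards [hev, hball] with t ht ht'
      exact (hF.hasDerivAt_isHeatZeroPath hζ ht' ht).deriv
    rw [taylorSeq, pathCoeff, iteratedDeriv_succ', h.iteratedDeriv_eq, hiter]

lemma IsHeatZeroPath.hasSum {F : ℂ → ℂ} (hF : HeatTame F) (h1 : deriv F 0 ≠ 0)
    {r : ℝ} {ζ : ℂ → ℂ} (hζ : IsHeatZeroPath F 0 r ζ) {τ : ℂ} (hτ : τ ∈ ball (0 : ℂ) r) :
    HasSum (fun k => pathCoeff F k * τ ^ k) (ζ τ) := by
  have hr : 0 < r := pos_of_mem_ball hτ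
  rw [← hζ.taylorSeq_eq hF h1 hr]
  refine (Complex.hasSum_taylorSeries_on_ball hζ.1 hτ).congr_fun fun k => ?_
  simp only [taylorSeq, sub_zero, smul_eq_mul]
  ring

/-- The power series with coefficients `c` has radius of convergence at least `r`, phrased through
countably many summability conditions so as to be a measurable condition on `c`. -/
def ConvergesOnBall (c : ℕ → ℂ) (r : ℝ) : Prop :=
  ∀ N : ℕ, Summable fun k => ‖c k‖ * (r * (N / (N + 1))) ^ k

lemma exists_lt_mul_div {r s : ℝ} (hs : 0 ≤ s) (h : s < r) : ∃ N : ℕ, s < r * (N / (N + 1)) := by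
  have hr : 0 < r := hs.trans_lt h
  have : Filter.Tendsto (fun N : ℕ => r * ((N : ℝ) / (N + 1))) Filter.atTop (nhds (r * 1)) :=
    tendsto_natCast_div_add_atTop (1 : ℝ) |>.const_mul r
  rw [mul_one] at this
  exact (this.eventually (lt_mem_nhds h)).exists

lemma ConvergesOnBall.differentiableOn {c : ℕ → ℂ} {r : ℝ} (hc : ConvergesOnBall c r) :
    DifferentiableOn ℂ (fun τ => ∑' k, c k * τ ^ k) (ball 0 r) := by
  intro τ hτ
  obtain ⟨N, hN⟩ := exists_lt_mul_div (norm_nonneg τ) (mem_ball_zero_iff.1 hτ)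
  have h := Complex.differentiableOn_tsum_of_summable_norm (hc N) (F := fun k τ => c k * τ ^ k)
    (U := ball 0 (r * (N / (N + 1)))) (fun k => by fun_prop) isOpen_ball (fun k w hw => by
      rw [norm_mul, norm_pow]
      gcongr
      exact (mem_ball_zero_iff.1 hw).le)
  have hτ' : τ ∈ ball (0 : ℂ) (r * (N / (N + 1))) := mem_ball_zero_iff.2 hN
  exact (h.differentiableAt (isOpen_ball.mem_nhds hτ')).differentiableWithinAt

lemma convergesOnBall_of_forall_summable {c : ℕ → ℂ} {r : ℝ} (hr : 0 < r)
    (h : ∀ τ ∈ ball (0 : ℂ) r, Summable fun k => c k * τ ^ k) : ConvergesOnBall c r := by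
  intro N
  have hN : (N : ℝ) / (N + 1) < 1 := by rw [div_lt_one (by positivity)]; linarith
  have := (h ((r * (N / (N + 1)) : ℝ) : ℂ) (by
    rw [mem_ball_zero_iff, Complex.norm_real, Real.norm_of_nonneg (by positivity)]
    nlinarith)).norm
  refine this.congr fun k => ?_
  rw [norm_mul, norm_pow, Complex.norm_real, Real.norm_of_nonneg (by positivity)]

/-- For `r ≤ 1` the zero path exists on the disk of radius `r` exactly when its Taylor series
converges there: the equation satisfied near `0` propagates to the disk by the identity theorem.
-/
lemma HeatTame.exists_isHeatZeroPath_iff {F : ℂ → ℂ} (hF : HeatTame F) (h0 : F 0 = 0)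
    (h1 : deriv F 0 ≠ 0) {r : ℝ} (hr : 0 < r) (hr1 : r ≤ 1) {n : ℕ} (m : Fin n → ℂ)
    (t : Fin n → ℂ) (ht : ∀ i, t i ∈ ball (0 : ℂ) r) (B : Set (Fin n → ℂ)) :
    (∃ ζ : ℂ → ℂ, IsHeatZeroPath F 0 r ζ ∧ (fun i => m i + ζ (t i)) ∈ B) ↔
      ConvergesOnBall (pathCoeff F) r ∧
        (fun i => m i + ∑' k, pathCoeff F k * t i ^ k) ∈ B := by
  constructor
  · rintro ⟨ζ, hζ, hB⟩
    refine ⟨convergesOnBall_of_forall_summable hr fun τ hτ => (hζ.hasSum hF h1 hτ).summable, ?_⟩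
    convert hB using 3 with i
    exact (hζ.hasSum hF h1 (ht i)).tsum_eq
  · rintro ⟨hc, hB⟩
    refine ⟨fun τ => ∑' k, pathCoeff F k * τ ^ k, ⟨hc.differentiableOn, ?_, ?_⟩, hB⟩
    · beta_reduce
      rw [tsum_eq_single 0 (fun k hk => by simp [hk])]
      simp [pathCoeff]
    · obtain ⟨r₀, hr₀, ζ₀, hζ₀⟩ := hF.exists_isHeatZeroPath h0 h1
      have hd : DifferentiableOn ℂ
          (fun τ => heatFlow τ F (∑' k, pathCoeff F k * τ ^ k)) (ball 0 r) := fun τ hτ =>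
        (hF.hasDerivAt_heatFlow_comp ((mem_ball_zero_iff.1 hτ).trans_le hr1)
          (hc.differentiableOn.differentiableAt
            (isOpen_ball.mem_nhds hτ)).hasDerivAt).differentiableAt.differentiableWithinAt
      have hz : (fun τ => heatFlow τ F (∑' k, pathCoeff F k * τ ^ k)) =ᶠ[nhds 0] 0 := by
        filter_upwards [ball_mem_nhds (0 : ℂ) hr₀] with τ hτ
        rw [(hζ₀.hasSum hF h1 hτ).tsum_eq]
        exact (hζ₀.2.2 τ hτ).2
      have hzero := (hd.analyticOnNhd isOpen_ball).eqOn_zero_of_preconnected_of_eventuallyEq_zero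
        (convex_ball _ _).isPreconnected (mem_ball_self hr) hz
      exact fun τ hτ => ⟨hF.summable_heatTerm ((mem_ball_zero_iff.1 hτ).trans_le hr1) _,
        hzero hτ⟩

/-! ### Measurability on the space of entire functions -/

lemma measurable_entireFun_iff {α : Type*} [MeasurableSpace α] {f : α → EntireFun} :
    Measurable f ↔ ∀ z, Measurable fun x => (f x).1 z := by
  refine ⟨fun h z => (measurable_pi_apply z).comp (measurable_subtype_coe.comp h), fun h => ?_⟩
  have : f = fun x => ⟨(f x).1, (f x).2⟩ := rfl
  rw [this]
  exact Measurable.subtype_mk (measurable_pi_iff.2 h)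

lemma measurable_entireFun_eval (z : ℂ) : Measurable fun g : EntireFun => g.1 z :=
  measurable_entireFun_iff.1 measurable_id z

/-- Derivatives are limits of difference quotients, hence measurable for the evaluation σ-algebra.
-/
lemma measurable_iteratedDeriv_entireFun (n : ℕ) (z : ℂ) :
    Measurable fun g : EntireFun => iteratedDeriv n g.1 z := by
  induction n generalizing z with
  | zero => simpa using measurable_entireFun_eval z
  | succ n ih =>
    refine measurable_of_tendsto_metrizable (f := fun (m : ℕ) (g : EntireFun) =>
      ((m : ℂ) + 1) * (iteratedDeriv n g.1 (z + ((m : ℂ) + 1)⁻¹) - iteratedDeriv n g.1 z))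
      (fun m => ((ih _).sub (ih _)).const_mul _) (tendsto_pi_nhds.2 fun g => ?_)
    rw [iteratedDeriv_succ]
    have hd : Differentiable ℂ (iteratedDeriv n g.1) :=
      g.2.contDiff.differentiable_iteratedDeriv (n := ⊤) n (by simp)
    have h := (hd z).hasDerivAt.tendsto_slope_zero
    have h0 : Filter.Tendsto (fun m : ℕ => ((m : ℂ) + 1)⁻¹) Filter.atTop (nhdsWithin 0 {0}ᶜ) := by
      refine tendsto_nhdsWithin_iff.2 ⟨?_, Filter.Eventually.of_forall fun m => ?_⟩
      · have := tendsto_one_div_add_atTop_nhds_zero_nat (𝕜 := ℂ)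
        simpa using this
      · simpa using Nat.cast_add_one_ne_zero m
    refine (h.comp h0).congr fun m => ?_
    simp

lemma measurableSet_summable {α : Type*} [MeasurableSpace α] {f : ℕ → α → ℝ}
    (hf : ∀ n, Measurable (f n)) : MeasurableSet {x | Summable fun n => f n x} :=
  measurableSet_exists_tendsto (l := (SummationFilter.unconditional ℕ).filter) (by fun_prop)

lemma measurable_jetAtZero (i : Option ℕ) : Measurable fun g : EntireFun => jetAtZero g.1 i := by
  match i with
  | some j => exact measurable_iteratedDeriv_entireFun j 0
  | none =>
    have := measurable_iteratedDeriv_entireFun 1 0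
    simp only [iteratedDeriv_one] at this
    exact this.inv

lemma measurable_pathCoeff (n : ℕ) : Measurable fun g : EntireFun => pathCoeff g.1 n := by
  have h : ∀ p : MvPolynomial (Option ℕ) ℂ,
      Measurable fun g : EntireFun => MvPolynomial.aeval (jetAtZero g.1) p := by
    intro p
    induction p using MvPolynomial.induction_on with
    | C c => simp
    | add p q hp hq =>
      simp only [map_add]
      exact hp.add hq
    | mul_X p i hp =>
      simp only [map_mul, MvPolynomial.aeval_X]
      exact hp.mul (measurable_jetAtZero i)
  match n with
  | 0 => exact measurable_const
  | n + 1 => exact (h _).div_const _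

/-- The entire functions with a simple zero at `0` whose coefficients with respect to `zⁿ / √(n!)`
grow at most quadratically. The quadratic bound is a convenient almost sure property of the GAF.
-/
def regularZeroSet : Set EntireFun :=
  {g | (∃ C : ℕ, ∀ n : ℕ,
      ‖iteratedDeriv n g.1 0‖ ≤ C * ((n : ℝ) + 1) ^ 2 * √(n.factorial : ℝ)) ∧
    g.1 0 = 0 ∧ deriv g.1 0 ≠ 0}

lemma measurableSet_regularZeroSet : MeasurableSet regularZeroSet := by
  have h1 := measurable_iteratedDeriv_entireFun 1 0
  simp only [iteratedDeriv_one] at h1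
  have h : regularZeroSet = (⋃ C : ℕ, ⋂ n : ℕ, {g : EntireFun |
      ‖iteratedDeriv n g.1 0‖ ≤ C * ((n : ℝ) + 1) ^ 2 * √(n.factorial : ℝ)}) ∩
        ({g | g.1 0 = 0} ∩ {g | deriv g.1 0 ≠ 0}) := by
    ext g; simp [regularZeroSet]
  rw [h]
  refine MeasurableSet.inter ?_ (MeasurableSet.inter ?_ ?_)
  · exact MeasurableSet.iUnion fun C => MeasurableSet.iInter fun n =>
      measurableSet_le (measurable_iteratedDeriv_entireFun n 0).norm measurable_const
  · exact measurable_entireFun_eval 0 (measurableSet_singleton 0)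
  · exact h1 (measurableSet_singleton 0).compl

lemma heatTame_of_mem_regularZeroSet {g : EntireFun} (hg : g ∈ regularZeroSet) : HeatTame g.1 :=
  heatTame_of_norm_iteratedDeriv_zero_le g.2 hg.1.choose_spec

lemma measurableSet_convergesOnBall (r : ℝ) :
    MeasurableSet {g : EntireFun | ConvergesOnBall (pathCoeff g.1) r} := by
  simp only [ConvergesOnBall, Set.ofPred_forall]
  exact MeasurableSet.iInter fun N =>
    measurableSet_summable fun k => (measurable_pathCoeff k).norm.mul_const _

/-- A finite measure on `ℂⁿ` is determined by the integrals of `exp(i Re Σ cⱼ vⱼ)`. -/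
lemma measure_ext_of_charFun_pi {ι : Type*} [Fintype ι] {μ ν : Measure (ι → ℂ)}
    [IsFiniteMeasure μ] [IsFiniteMeasure ν]
    (h : ∀ c : ι → ℂ, ∫ v, Complex.exp (((∑ i, c i * v i).re : ℝ) * Complex.I) ∂μ =
      ∫ v, Complex.exp (((∑ i, c i * v i).re : ℝ) * Complex.I) ∂ν) : μ = ν := by
  classical
  refine Measure.ext_of_charFunDual (funext fun L => ?_)
  rw [charFunDual_apply, charFunDual_apply]
  have hL : ∀ v : ι → ℂ, L v = (∑ i, ((L (Pi.single i 1) : ℝ) -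
      (L (Pi.single i Complex.I) : ℝ) * Complex.I : ℂ) * v i).re := by
    intro v
    have hv : v = ∑ i, ((v i).re • (Pi.single i 1 : ι → ℂ) +
        (v i).im • (Pi.single i Complex.I : ι → ℂ)) := by
      funext j
      rw [Finset.sum_apply, Finset.sum_eq_single j]
      · simp
      · intro i _ hij; simp [hij.symm]
      · simp
    conv_lhs => rw [hv]
    simp only [map_sum, map_add, map_smul, smul_eq_mul, Complex.re_sum]
    refine Finset.sum_congr rfl fun i _ => ?_
    simp
    ring
  refine (integral_congr_ae (Filter.Eventually.of_forall fun v => ?_)).trans ((h fun i =>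
    (L (Pi.single i 1) : ℝ) - (L (Pi.single i Complex.I) : ℝ) * Complex.I).trans
    (integral_congr_ae (Filter.Eventually.of_forall fun v => ?_)))
  · rw [← hL v]
  · beta_reduce; rw [← hL v]

/-- A finite measure on entire functions is determined by the characteristic functions of finite
linear combinations of point values. -/
lemma measure_ext_entireFun {μ ν : Measure EntireFun} [IsFiniteMeasure μ] [IsFiniteMeasure ν]
    (h : ∀ (I : Finset ℂ) (c : I → ℂ),
      ∫ g, Complex.exp (((∑ i, c i * g.1 i.1).re : ℝ) * Complex.I) ∂μ =
      ∫ g, Complex.exp (((∑ i, c i * g.1 i.1).re : ℝ) * Complex.I) ∂ν) : μ = ν := by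
  have hval : Measurable (Subtype.val : EntireFun → ℂ → ℂ) := measurable_subtype_coe
  have hmap : μ.map Subtype.val = ν.map Subtype.val := by
    refine IsProjectiveLimit.unique (P := fun I => (ν.map Subtype.val).map I.restrict)
      (fun I => ?_) (fun I => rfl)
    refine measure_ext_of_charFun_pi fun c => ?_
    have hr : Measurable (I.restrict : (ℂ → ℂ) → I → ℂ) := Finset.measurable_restrict I
    have hm : Measurable fun v : I → ℂ =>
        Complex.exp (((∑ i, c i * v i).re : ℝ) * Complex.I) := by fun_prop
    rw [integral_map hr.aemeasurable hm.aestronglyMeasurable,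
      integral_map hr.aemeasurable hm.aestronglyMeasurable,
      integral_map (f := fun x => Complex.exp (((∑ i, c i * I.restrict x i).re : ℝ) * Complex.I))
        hval.aemeasurable (hm.comp hr).aestronglyMeasurable,
      integral_map (f := fun x => Complex.exp (((∑ i, c i * I.restrict x i).re : ℝ) * Complex.I))
        hval.aemeasurable (hm.comp hr).aestronglyMeasurable]
    exact h I c
  ext s ⟨t, ht, hts⟩
  rw [← hts, ← Measure.map_apply hval ht, ← Measure.map_apply hval ht, hmap]

/-! ### Characteristic functions of the Gaussian analytic function -/

lemma measurable_stdComplexGaussian_density :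
    Measurable fun z : ℂ => ENNReal.ofReal (Real.pi⁻¹ * Real.exp (-‖z‖ ^ 2)) := by fun_prop

lemma charFun_stdComplexGaussian (t : ℂ) :
    charFun stdComplexGaussian t = Complex.exp (((-(‖t‖ ^ 2) / 4 : ℝ)) : ℂ) := by
  rw [charFun_apply, stdComplexGaussian, integral_withDensity_eq_integral_toReal_smul
    measurable_stdComplexGaussian_density
    (Filter.Eventually.of_forall fun _ => ENNReal.ofReal_lt_top)]
  have h := GaussianFourier.integral_cexp_neg_mul_sq_norm_add (V := ℂ) (b := 1) (by simp)
    Complex.I t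
  have h2 : ∀ z : ℂ, (ENNReal.ofReal (Real.pi⁻¹ * Real.exp (-‖z‖ ^ 2))).toReal •
      Complex.exp (inner ℝ z t * Complex.I) = (Real.pi⁻¹ : ℂ) *
        Complex.exp (-1 * ‖z‖ ^ 2 + Complex.I * inner ℝ t z) := by
    intro z
    rw [ENNReal.toReal_ofReal (by positivity), Complex.real_smul, Complex.exp_add,
      real_inner_comm t z]
    push_cast
    rw [mul_assoc]
    ring_nf
  simp only [h2]
  rw [integral_const_mul, h, Complex.finrank_real_complex]
  have : (Real.pi : ℂ) ≠ 0 := by exact_mod_cast Real.pi_ne_zero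
  simp only [div_one, Nat.cast_ofNat, ne_eq, OfNat.ofNat_ne_zero, not_false_eq_true, div_self,
    Complex.cpow_one, mul_one, Complex.I_sq]
  rw [← mul_assoc, inv_mul_cancel₀ this, one_mul]
  push_cast
  ring_nf

lemma volume_absolutelyContinuous_stdComplexGaussian :
    (volume : Measure ℂ) ≪ stdComplexGaussian := by
  refine withDensity_absolutelyContinuous' measurable_stdComplexGaussian_density.aemeasurable
    (Filter.Eventually.of_forall fun z => ?_)
  simp only [ne_eq, ENNReal.ofReal_eq_zero, not_le]
  positivity

lemma stdComplexGaussian_absolutelyContinuous : stdComplexGaussian ≪ (volume : Measure ℂ) :=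
  withDensity_absolutelyContinuous _ _

lemma lintegral_enorm_stdComplexGaussian_ne_top : ∫⁻ z, ‖z‖ₑ ∂stdComplexGaussian ≠ ⊤ := by
  have h := (GaussianFourier.integrable_cexp_neg_mul_sq_norm_add (V := ℂ) (b := 1 / 2) (by norm_num)
    0 0).norm
  have h3 : Integrable fun z : ℂ => Real.pi⁻¹ * (‖z‖ * Real.exp (-‖z‖ ^ 2)) := by
    refine (h.mono' (by fun_prop) (Filter.Eventually.of_forall fun z => ?_)).const_mul _
    rw [Real.norm_of_nonneg (by positivity), Complex.norm_exp]
    have e : ‖z‖ ≤ Real.exp (‖z‖ ^ 2 / 2) := by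
      have := Real.add_one_le_exp (‖z‖ ^ 2 / 2)
      nlinarith [sq_nonneg (‖z‖ - 1)]
    calc ‖z‖ * Real.exp (-‖z‖ ^ 2) ≤ Real.exp (‖z‖ ^ 2 / 2) * Real.exp (-‖z‖ ^ 2) := by gcongr
      _ = Real.exp (-‖z‖ ^ 2 / 2) := by rw [← Real.exp_add]; ring_nf
      _ ≤ _ := by
        refine (congrArg Real.exp ?_).le
        have : (-(1 / 2 : ℂ) * (‖z‖ : ℂ) ^ 2 + 0 * ((inner ℝ (0 : ℂ) z : ℝ) : ℂ)) =
          ((-‖z‖ ^ 2 / 2 : ℝ) : ℂ) := by push_cast; ring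
        rw [this, Complex.ofReal_re]
  rw [stdComplexGaussian, lintegral_withDensity_eq_lintegral_mul _
    measurable_stdComplexGaussian_density measurable_enorm]
  have := h3.lintegral_lt_top
  refine ne_of_lt (lt_of_le_of_lt (lintegral_mono fun z => ?_) this)
  simp only [Pi.mul_apply]
  rw [← ofReal_norm, ← ENNReal.ofReal_mul (by positivity)]
  refine ENNReal.ofReal_le_ofReal (le_of_eq (by ring))

lemma norm_exp_re_mul_I (x : ℝ) : ‖Complex.exp (x * Complex.I)‖ = 1 :=
  Complex.norm_exp_ofReal_mul_I x

section

variable {Ω : Type*} [MeasurableSpace Ω] {P : Measure Ω}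

lemma integral_exp_re_mul_stdComplexGaussian (b : ℂ) :
    ∫ z, Complex.exp (((b * z).re : ℝ) * Complex.I) ∂stdComplexGaussian =
      Complex.exp (((-(‖b‖ ^ 2) / 4 : ℝ)) : ℂ) := by
  have h := charFun_stdComplexGaussian (starRingEnd ℂ b)
  rw [charFun_apply, RCLike.norm_conj] at h
  rw [← h]
  refine integral_congr_ae (Filter.Eventually.of_forall fun z => ?_)
  simp [Complex.inner]

lemma integral_exp_re_gaussian_sum {ξ : ℕ → Ω → ℂ}
    (hlaw : ∀ n, HasLaw (ξ n) stdComplexGaussian P) (hind : iIndepFun ξ P) (b : ℕ → ℂ) (N : ℕ) :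
    ∫ ω, Complex.exp (((∑ n ∈ Finset.range N, b n * ξ n ω).re : ℝ) * Complex.I) ∂P =
      Complex.exp (((-(∑ n ∈ Finset.range N, ‖b n‖ ^ 2) / 4 : ℝ)) : ℂ) := by
  have := hind.isProbabilityMeasure
  have hm : ∀ n, AEMeasurable (fun ω => b n * ξ n ω) P := fun n =>
    (hlaw n).aemeasurable.const_mul _
  have hind' : iIndepFun (fun n ω => b n * ξ n ω) P :=
    hind.comp (fun n z => b n * z) fun n => measurable_const_mul _
  have h := congrFun ((hind'.restrict (Finset.range N)).charFun_map_fun_finsetSum_eq_prod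
    (fun i _ => hm i)) 1
  rw [charFun_apply, integral_map (Finset.aemeasurable_fun_sum _ fun i _ => hm i)
    (by fun_prop), Finset.prod_apply] at h
  have h2 : ∀ n, charFun (P.map fun ω => b n * ξ n ω) 1 =
      Complex.exp (((-(‖b n‖ ^ 2) / 4 : ℝ)) : ℂ) := by
    intro n
    rw [charFun_apply, integral_map (hm n) (by fun_prop), ← integral_exp_re_mul_stdComplexGaussian,
      ← (hlaw n).map_eq, integral_map (hlaw n).aemeasurable (by fun_prop)]
    simp [Complex.inner]
  simp only [h2] at h
  rw [← Complex.exp_sum] at h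
  calc _ = _ := by
        refine integral_congr_ae (Filter.Eventually.of_forall fun ω => ?_)
        simp [Complex.inner]
    _ = _ := h
    _ = _ := by
      congr 1
      push_cast
      rw [neg_div, Finset.sum_div, ← Finset.sum_neg_distrib]
      simp only [neg_div]

lemma integral_exp_re_gaussian_series {ξ : ℕ → Ω → ℂ}
    (hlaw : ∀ n, HasLaw (ξ n) stdComplexGaussian P) (hind : iIndepFun ξ P) {b : ℕ → ℂ} {V : ℝ}
    (hb : HasSum (fun n => ‖b n‖ ^ 2) V) {S : Ω → ℂ}
    (hS : ∀ᵐ ω ∂P, HasSum (fun n => b n * ξ n ω) (S ω)) :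
    ∫ ω, Complex.exp (((S ω).re : ℝ) * Complex.I) ∂P = Complex.exp (((-V / 4 : ℝ)) : ℂ) := by
  have := hind.isProbabilityMeasure
  have h1 : Filter.Tendsto (fun N => ∫ ω, Complex.exp
      (((∑ n ∈ Finset.range N, b n * ξ n ω).re : ℝ) * Complex.I) ∂P) Filter.atTop
      (nhds (∫ ω, Complex.exp (((S ω).re : ℝ) * Complex.I) ∂P)) := by
    refine tendsto_integral_of_dominated_convergence (fun _ => 1) (fun N => ?_)
      (integrable_const _) (fun N => Filter.Eventually.of_forall fun ω => ?_) ?_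
    · have hm : AEMeasurable (fun ω => ∑ n ∈ Finset.range N, b n * ξ n ω) P :=
        Finset.aemeasurable_fun_sum _ fun i _ => (hlaw i).aemeasurable.const_mul _
      exact ((Complex.measurable_exp.comp ((Complex.measurable_ofReal.comp
        Complex.measurable_re).mul_const Complex.I)).comp_aemeasurable hm).aestronglyMeasurable
    · exact (norm_exp_re_mul_I _).le
    · filter_upwards [hS] with ω hω
      have hc : Continuous fun z : ℂ => Complex.exp ((z.re : ℝ) * Complex.I) := by fun_prop
      exact (hc.tendsto _).comp hω.tendsto_sum_nat
  simp only [integral_exp_re_gaussian_sum hlaw hind] at h1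
  have h2 : Filter.Tendsto (fun N => Complex.exp
      (((-(∑ n ∈ Finset.range N, ‖b n‖ ^ 2) / 4 : ℝ)) : ℂ)) Filter.atTop
      (nhds (Complex.exp (((-V / 4 : ℝ)) : ℂ))) := by
    have hc : Continuous fun x : ℝ => Complex.exp (((-x / 4 : ℝ)) : ℂ) := by fun_prop
    exact (hc.tendsto _).comp hb.tendsto_sum_nat
  exact tendsto_nhds_unique h1 h2

/-- The variance of `Σ cᵢ G(wᵢ)` for the flat GAF, whose covariance kernel is `exp(z w̄)`. -/
noncomputable def gafCov {ι : Type*} [Fintype ι] (c w : ι → ℂ) : ℂ :=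
  ∑ i, ∑ j, c i * starRingEnd ℂ (c j) * Complex.exp (w i * starRingEnd ℂ (w j))

lemma hasSum_gafCov {ι : Type*} [Fintype ι] (c w : ι → ℂ) :
    HasSum (fun n : ℕ => ‖∑ i, c i * (w i ^ n / (√(n.factorial : ℝ) : ℂ))‖ ^ 2)
      (gafCov c w).re := by
  have h : HasSum (fun n : ℕ => ∑ i, ∑ j, c i * starRingEnd ℂ (c j) *
      ((w i * starRingEnd ℂ (w j)) ^ n / (n.factorial : ℂ))) (gafCov c w) := by
    refine hasSum_sum fun i _ => hasSum_sum fun j _ => HasSum.mul_left _ ?_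
    rw [Complex.exp_eq_exp_ℂ]
    exact NormedSpace.expSeries_div_hasSum_exp _
  refine (Complex.hasSum_re h).congr_fun fun n => ?_
  rw [← Complex.ofReal_re (‖_‖ ^ 2)]
  congr 1
  rw [Complex.ofReal_pow, ← Complex.mul_conj', map_sum, Finset.sum_mul_sum]
  refine Finset.sum_congr rfl fun i _ => Finset.sum_congr rfl fun j _ => ?_
  have hs : (√(n.factorial : ℝ) : ℂ) * (√(n.factorial : ℝ) : ℂ) = (n.factorial : ℂ) := by
    rw [← Complex.ofReal_mul, Real.mul_self_sqrt (by positivity)]; simp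
  rw [← hs]
  simp only [map_mul, map_div₀, map_pow, Complex.conj_ofReal, mul_pow]
  have : (√(n.factorial : ℝ) : ℂ) ≠ 0 := by
    rw [Ne, Complex.ofReal_eq_zero, Real.sqrt_eq_zero (by positivity)]
    exact_mod_cast n.factorial_ne_zero
  field_simp

/-- The finite-dimensional characteristic functions of the flat GAF. -/
lemma IsGAF.integral_exp_re {G : Ω → EntireFun} (hG : IsGAF P G) {ι : Type*} [Fintype ι]
    (c w : ι → ℂ) :
    ∫ ω, Complex.exp (((∑ i, c i * (G ω).1 (w i)).re : ℝ) * Complex.I) ∂P =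
      Complex.exp (((-(gafCov c w).re / 4 : ℝ)) : ℂ) := by
  obtain ⟨ξ, hlaw, hind, hsum⟩ := hG
  refine integral_exp_re_gaussian_series hlaw hind (hasSum_gafCov c w) ?_
  filter_upwards [hsum] with ω hω
  refine (hasSum_sum fun i (_ : i ∈ Finset.univ) => (hω (w i)).mul_left (c i)).congr_fun fun n => ?_
  rw [Finset.sum_mul]
  exact Finset.sum_congr rfl fun i _ => by ring

/-- A random function which is a.s. the sum of the Gaussian series is a.e. measurable for the
evaluation σ-algebra: the series defines an entire function on a measurable event of full
probability. -/
lemma IsGAF.aemeasurable {G : Ω → EntireFun} (hG : IsGAF P G) : AEMeasurable G P := by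
  obtain ⟨ξ, hlaw, hind, hsum⟩ := hG
  let η : ℕ → Ω → ℂ := fun n => (hlaw n).aemeasurable.mk (ξ n)
  have hη : ∀ n, Measurable (η n) := fun n => (hlaw n).aemeasurable.measurable_mk
  let c : ℕ → Ω → ℂ := fun n ω => η n ω / (√(n.factorial : ℝ) : ℂ)
  let E : Set Ω := {ω | ∀ K : ℕ, Summable fun n => ‖c n ω‖ * (K : ℝ) ^ n}
  have hE : MeasurableSet E := by
    simp only [E, Set.ofPred_forall]
    exact MeasurableSet.iInter fun K => measurableSet_summable fun n =>
      ((hη n).div_const _).norm.mul_const _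
  have hdiff : ∀ ω ∈ E, Differentiable ℂ fun z => ∑' n, c n ω * z ^ n := by
    intro ω hω z
    obtain ⟨K, hK⟩ := exists_nat_gt ‖z‖
    have hc : ConvergesOnBall (fun n => c n ω) K := fun N => by
      refine Summable.of_nonneg_of_le (fun n => by positivity) (fun n => ?_) (hω K)
      have : (N : ℝ) / (N + 1) ≤ 1 := by rw [div_le_one (by positivity)]; linarith
      gcongr
      exact mul_le_of_le_one_right (by positivity) this
    exact hc.differentiableOn.differentiableAt (isOpen_ball.mem_nhds (by simpa using hK))
  classical
  refine ⟨fun ω => if h : ω ∈ E then ⟨fun z => ∑' n, c n ω * z ^ n, hdiff ω h⟩ else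
    ⟨fun _ => 0, differentiable_const 0⟩, ?_, ?_⟩
  · refine measurable_entireFun_iff.2 fun z => ?_
    have h1 : Measurable fun ω => ∑' n, c n ω * z ^ n :=
      Measurable.tsum fun n => ((hη n).div_const _).mul_const _
    have h2 : Measurable fun ω => if ω ∈ E then ∑' n, c n ω * z ^ n else 0 :=
      Measurable.ite hE h1 (measurable_const (a := (0 : ℂ)))
    convert h2 using 2 with ω
    split_ifs <;> rfl
  · have hξη : ∀ᵐ ω ∂P, ∀ n, ξ n ω = η n ω :=
      ae_all_iff.2 fun n => (hlaw n).aemeasurable.ae_eq_mk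
    filter_upwards [hsum, hξη] with ω h1 h2
    have h3 : ∀ z, HasSum (fun n => c n ω * z ^ n) ((G ω).1 z) := fun z => by
      refine (h1 z).congr_fun fun n => ?_
      rw [h2 n]
      simp only [c]
      ring
    have hωE : ω ∈ E := fun K => by
      refine (h3 K).summable.norm.congr fun n => ?_
      simp
    rw [dif_pos hωE]
    exact Subtype.ext (funext fun z => ((h3 z).tsum_eq).symm)

lemma iteratedDeriv_zero_of_forall_hasSum {f : ℂ → ℂ} {c : ℕ → ℂ}
    (h : ∀ z, HasSum (fun n => c n * z ^ n) (f z)) (hf : Differentiable ℂ f) (n : ℕ) :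
    iteratedDeriv n f 0 = n.factorial * c n := by
  have h1 : HasFPowerSeriesAt f (FormalMultilinearSeries.ofScalars ℂ c) 0 := by
    rw [hasFPowerSeriesAt_iff]
    refine Filter.Eventually.of_forall fun z => ?_
    simpa [FormalMultilinearSeries.coeff_ofScalars, mul_comm] using h z
  have h2 : HasFPowerSeriesAt f (FormalMultilinearSeries.ofScalars ℂ
      (fun n => (n.factorial : ℂ)⁻¹ * iteratedDeriv n f 0)) 0 := by
    rw [hasFPowerSeriesAt_iff]
    refine Filter.Eventually.of_forall fun z => ?_
    have := Complex.hasSum_taylorSeries_of_entire hf 0 z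
    simpa [FormalMultilinearSeries.coeff_ofScalars, mul_comm, mul_left_comm] using this
  have h3 := congrArg (fun p => FormalMultilinearSeries.coeff p n)
    (h1.eq_formalMultilinearSeries h2)
  simp only [FormalMultilinearSeries.coeff_ofScalars] at h3
  rw [h3]
  have : (n.factorial : ℂ) ≠ 0 := by exact_mod_cast n.factorial_ne_zero
  field_simp

lemma IsGAF.ae_regular {G : Ω → EntireFun} (hG : IsGAF P G) :
    ∀ᵐ ω ∂P, (∃ C : ℕ, ∀ n : ℕ,
      ‖iteratedDeriv n (G ω).1 0‖ ≤ C * ((n : ℝ) + 1) ^ 2 * √(n.factorial : ℝ)) ∧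
      deriv (G ω).1 0 ≠ 0 := by
  obtain ⟨ξ, hlaw, hind, hsum⟩ := hG
  have hne : ∀ᵐ ω ∂P, ξ 1 ω ≠ 0 := by
    have h : ∀ᵐ z ∂stdComplexGaussian, z ≠ 0 := by
      refine stdComplexGaussian_absolutelyContinuous.ae_le ?_
      exact measure_eq_zero_iff_ae_notMem.1 (measure_singleton (0 : ℂ))
    rw [← (hlaw 1).map_eq] at h
    exact ae_of_ae_map (hlaw 1).aemeasurable h
  have hgrow : ∀ᵐ ω ∂P, ∃ C : ℕ, ∀ n : ℕ, ‖ξ n ω‖ ≤ C * ((n : ℝ) + 1) ^ 2 := by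
    -- `∑ |ξₙ| / (n + 1)²` has finite expectation, so it is almost surely finite
    have hm : ∀ n : ℕ, AEMeasurable (fun ω => ENNReal.ofReal (((n : ℝ) + 1) ^ 2)⁻¹ * ‖ξ n ω‖ₑ) P :=
      fun n => (hlaw n).aemeasurable.enorm.const_mul _
    have hfin : ∫⁻ ω, ∑' n : ℕ, ENNReal.ofReal (((n : ℝ) + 1) ^ 2)⁻¹ * ‖ξ n ω‖ₑ ∂P ≠ ⊤ := by
      rw [lintegral_tsum hm]
      have : ∀ n : ℕ, ∫⁻ ω, ENNReal.ofReal (((n : ℝ) + 1) ^ 2)⁻¹ * ‖ξ n ω‖ₑ ∂P =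
          ENNReal.ofReal (((n : ℝ) + 1) ^ 2)⁻¹ * ∫⁻ z, ‖z‖ₑ ∂stdComplexGaussian := fun n => by
        rw [lintegral_const_mul'' _ (hlaw n).aemeasurable.enorm, ← (hlaw n).map_eq,
          lintegral_map' measurable_enorm.aemeasurable (hlaw n).aemeasurable]
      simp only [this]
      rw [ENNReal.tsum_mul_right]
      refine ENNReal.mul_ne_top ?_ lintegral_enorm_stdComplexGaussian_ne_top
      refine Summable.tsum_ofReal_ne_top ?_
      have := (summable_nat_add_iff (f := fun n : ℕ => ((n : ℝ) ^ 2)⁻¹) 1).2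
        (Real.summable_nat_pow_inv.2 one_lt_two)
      simpa using this
    filter_upwards [ae_lt_top' (AEMeasurable.tsum hm) hfin] with ω hω
    obtain ⟨C, hC⟩ := exists_nat_gt
      (∑' n : ℕ, ENNReal.ofReal (((n : ℝ) + 1) ^ 2)⁻¹ * ‖ξ n ω‖ₑ).toReal
    refine ⟨C, fun n => ?_⟩
    have h1 := ENNReal.le_tsum (f := fun n : ℕ => ENNReal.ofReal (((n : ℝ) + 1) ^ 2)⁻¹ * ‖ξ n ω‖ₑ) n
    have h2 := (ENNReal.toReal_mono hω.ne h1).trans hC.le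
    rw [ENNReal.toReal_mul, ENNReal.toReal_ofReal (by positivity), toReal_enorm,
      inv_mul_le_iff₀ (by positivity)] at h2
    linarith
  filter_upwards [hne, hgrow, hsum] with ω h1 h2 h3
  have h4 : ∀ n, iteratedDeriv n (G ω).1 0 =
      n.factorial * (ξ n ω / (√(n.factorial : ℝ) : ℂ)) :=
    iteratedDeriv_zero_of_forall_hasSum (fun z => (h3 z).congr_fun fun n => by ring) (G ω).2
  obtain ⟨C, hC⟩ := h2
  refine ⟨⟨C, fun n => ?_⟩, ?_⟩
  · rw [h4 n, norm_mul, norm_div, Complex.norm_natCast, Complex.norm_real,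
      Real.norm_of_nonneg (Real.sqrt_nonneg _)]
    have hp : (0 : ℝ) < n.factorial := by exact_mod_cast n.factorial_pos
    have hsq : (n.factorial : ℝ) = √(n.factorial : ℝ) * √(n.factorial : ℝ) :=
      (Real.mul_self_sqrt hp.le).symm
    have hs : 0 < √(n.factorial : ℝ) := Real.sqrt_pos.2 hp
    calc (n.factorial : ℝ) * (‖ξ n ω‖ / √(n.factorial : ℝ)) = ‖ξ n ω‖ * √(n.factorial : ℝ) := by
          nth_rewrite 1 [hsq]; field_simp
      _ ≤ _ := by gcongr; exact hC n
  · have := h4 1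
    rw [iteratedDeriv_one] at this
    rw [this]
    simpa using h1

end

/-! ### The conditional law given the value at a point -/

/-- `fockShift` as a map on entire functions. -/
noncomputable def fockShiftEntire (a : ℂ) (g : EntireFun) : EntireFun :=
  ⟨fockShift a g.1, differentiable_fockShift a g.2⟩

lemma measurable_fockShiftEntire (a : ℂ) : Measurable (fockShiftEntire a) :=
  measurable_entireFun_iff.2 fun z => (measurable_entireFun_eval (z - a)).const_mul _

lemma fockShiftEntire_neg_fockShiftEntire (a : ℂ) (g : EntireFun) :
    fockShiftEntire (-a) (fockShiftEntire a g) = g :=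
  Subtype.ext (fockShift_neg_fockShift a g.1)

lemma fockShiftEntire_fockShiftEntire_neg (a : ℂ) (g : EntireFun) :
    fockShiftEntire a (fockShiftEntire (-a) g) = g :=
  Subtype.ext (fockShift_fockShift_neg a g.1)

/-- Replace the value at `0` of `g` by `w`, keeping all its derivatives at `0`. -/
noncomputable def resetAtZero (w : ℂ) (g : EntireFun) : EntireFun :=
  ⟨fun z => w + (g.1 z - g.1 0), (g.2.sub_const _).const_add _⟩

/-- Reset the value at `a` to `w` in Fock-space coordinates centred at `a`: the translate to `a`
of `g` with its value at `0` replaced. The factor `exp(-|a|²/2)` makes the value at `a` equal to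
`w`. -/
noncomputable def resetAt (a w : ℂ) (g : EntireFun) : EntireFun :=
  fockShiftEntire a (resetAtZero (Complex.exp (-(starRingEnd ℂ a * a / 2)) * w) g)

lemma resetAt_apply_self (a w : ℂ) (g : EntireFun) : (resetAt a w g).1 a = w := by
  simp only [resetAt, fockShiftEntire, fockShift, resetAtZero, sub_self, add_zero]
  rw [← mul_assoc, ← Complex.exp_add]
  rw [show starRingEnd ℂ a * a - starRingEnd ℂ a * a / 2 + -(starRingEnd ℂ a * a / 2) = 0 by ring]
  simp

lemma Measurable.resetAt {α : Type*} [MeasurableSpace α] {f : α → ℂ} {g : α → EntireFun}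
    (hf : Measurable f) (hg : Measurable g) (a : ℂ) :
    Measurable fun x => resetAt a (f x) (g x) := by
  refine measurable_entireFun_iff.2 fun z => ?_
  have h1 : ∀ z, Measurable fun x => (g x).1 z := fun z => (measurable_entireFun_eval z).comp hg
  exact ((hf.const_mul _).add ((h1 _).sub (h1 _))).const_mul _

lemma measurable_resetAt (a : ℂ) : Measurable fun p : ℂ × EntireFun => resetAt a p.1 p.2 :=
  measurable_fst.resetAt measurable_snd a

lemma measurable_resetAt_right (a w : ℂ) : Measurable (resetAt a w) :=
  measurable_const.resetAt measurable_id a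

/-- The conditional law of the GAF with law `μ` given its value at `a`: keep the fluctuations of
the GAF and reset the value. -/
noncomputable def resetKernel (a : ℂ) (μ : Measure EntireFun) [IsProbabilityMeasure μ] :
    Kernel ℂ EntireFun :=
  (Kernel.id ×ₖ Kernel.const ℂ μ).map fun p => resetAt a p.1 p.2

lemma resetKernel_apply (a : ℂ) (μ : Measure EntireFun) [IsProbabilityMeasure μ] (w : ℂ) :
    resetKernel a μ w = μ.map (resetAt a w) := by
  rw [resetKernel, Kernel.map_apply _ (measurable_resetAt a), Kernel.prod_apply, Kernel.id_apply,
    Kernel.const_apply, Measure.dirac_prod, Measure.map_map (measurable_resetAt a)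
      measurable_prodMk_left]
  rfl

instance isMarkovKernel_resetKernel (a : ℂ) (μ : Measure EntireFun) [IsProbabilityMeasure μ] :
    IsMarkovKernel (resetKernel a μ) := by
  refine ⟨fun w => ?_⟩
  rw [resetKernel_apply]
  exact Measure.isProbabilityMeasure_map (measurable_resetAt_right a w).aemeasurable

lemma compProd_resetKernel (a : ℂ) (m : Measure ℂ) [SFinite m] (μ : Measure EntireFun)
    [IsProbabilityMeasure μ] :
    m.compProd (resetKernel a μ) = (m.prod μ).map fun p => (p.1, resetAt a p.1 p.2) := by
  have hm : Measurable fun p : ℂ × EntireFun => (p.1, resetAt a p.1 p.2) :=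
    measurable_fst.prodMk (measurable_resetAt a)
  ext s hs
  rw [Measure.compProd_apply hs, Measure.map_apply hm hs, Measure.prod_apply (hm hs)]
  refine lintegral_congr fun w => ?_
  rw [resetKernel_apply, Measure.map_apply (measurable_resetAt_right a w)
    (measurable_prodMk_left hs)]
  rfl

lemma continuous_integral_resetKernel (a : ℂ) (μ : Measure EntireFun) [IsProbabilityMeasure μ]
    {n : ℕ} (z : Fin n → ℂ) (f : BoundedContinuousFunction (Fin n → ℂ) ℝ) :
    Continuous fun w : ℂ => ∫ g, f (fun i => g.1 (z i)) ∂(resetKernel a μ w) := by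
  have hf : Measurable fun g : EntireFun => f fun i => g.1 (z i) :=
    f.continuous.measurable.comp (measurable_pi_iff.2 fun i => measurable_entireFun_eval (z i))
  have h : ∀ w : ℂ, ∫ g, f (fun i => g.1 (z i)) ∂(resetKernel a μ w) =
      ∫ g, f (fun i => (resetAt a w g).1 (z i)) ∂μ := fun w => by
    rw [resetKernel_apply, integral_map (measurable_resetAt_right a w).aemeasurable
      hf.aestronglyMeasurable]
  simp only [h]
  refine continuous_of_dominated (bound := fun _ => ‖f‖)
    (fun w => (hf.comp (measurable_resetAt_right a w)).aestronglyMeasurable)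
    (fun w => Filter.Eventually.of_forall fun g => f.norm_coe_le_norm _) (integrable_const _)
    (Filter.Eventually.of_forall fun g => f.continuous.comp (continuous_pi fun i => ?_))
  simp only [resetAt, fockShiftEntire, fockShift, resetAtZero]
  fun_prop

section

variable {Ω : Type*} [MeasurableSpace Ω] {P : Measure Ω}

/-- The kernel `exp(z w̄)` is invariant under Fock-space translations, and removing the value at
`0` removes exactly the variance of the constant term. -/
lemma gafCov_fockShift_reset {ι : Type*} [Fintype ι] (a : ℂ) (c w : ι → ℂ) :
    let d : ι → ℂ := fun i =>
      c i * Complex.exp (starRingEnd ℂ a * w i - starRingEnd ℂ a * a / 2)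
    ‖∑ i, d i‖ ^ 2 + (gafCov (fun o : Option ι => o.elim (-∑ i, d i) d)
      (fun o => o.elim 0 fun i => w i - a)).re = (gafCov c w).re := by
  intro d
  have h : ((‖∑ i, d i‖ ^ 2 : ℝ) : ℂ) + gafCov (fun o : Option ι => o.elim (-∑ i, d i) d)
      (fun o => o.elim 0 fun i => w i - a) = gafCov c w := by
    have hd : gafCov c w = ∑ i, ∑ j, d i * starRingEnd ℂ (d j) *
        Complex.exp ((w i - a) * starRingEnd ℂ (w j - a)) := by
      refine Finset.sum_congr rfl fun i _ => Finset.sum_congr rfl fun j _ => ?_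
      simp only [d, map_mul, ← Complex.exp_conj]
      rw [show w i * starRingEnd ℂ (w j) = (starRingEnd ℂ a * w i - starRingEnd ℂ a * a / 2) +
        starRingEnd ℂ (starRingEnd ℂ a * w j - starRingEnd ℂ a * a / 2) +
          (w i - a) * starRingEnd ℂ (w j - a) by
            simp only [map_sub, map_mul, map_div₀, map_ofNat, Complex.conj_conj]
            ring, Complex.exp_add, Complex.exp_add]
      ring
    rw [hd, Complex.ofReal_pow, ← Complex.mul_conj']
    simp only [gafCov, Fintype.sum_option, Option.elim_none, Option.elim_some, zero_mul, map_zero,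
      mul_zero, Complex.exp_zero, mul_one, Finset.sum_add_distrib, ← Finset.mul_sum,
      ← Finset.sum_mul, ← map_sum]
    simp only [map_neg]
    ring
  rw [← h, Complex.add_re, Complex.ofReal_re]

lemma IsGAF.integral_exp_re_map {G : Ω → EntireFun} (hG : IsGAF P G) {ι : Type*} [Fintype ι]
    (c w : ι → ℂ) :
    ∫ g, Complex.exp (((∑ i, c i * g.1 (w i)).re : ℝ) * Complex.I) ∂(P.map G) =
      Complex.exp (((-(gafCov c w).re / 4 : ℝ)) : ℂ) := by
  rw [← hG.integral_exp_re, integral_map hG.aemeasurable]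
  have : Measurable fun g : EntireFun => ∑ i, c i * g.1 (w i) :=
    Finset.measurable_fun_sum _ fun i _ => (measurable_entireFun_eval (w i)).const_mul _
  exact (Complex.measurable_exp.comp ((Complex.measurable_ofReal.comp
    (Complex.measurable_re.comp this)).mul_const _)).aestronglyMeasurable

lemma IsGAF.isProbabilityMeasure_map {G : Ω → EntireFun} (hG : IsGAF P G) :
    IsProbabilityMeasure (P.map G) := by
  have hm := hG.aemeasurable
  obtain ⟨ξ, hlaw, hind, -⟩ := hG
  have := hind.isProbabilityMeasure
  exact Measure.isProbabilityMeasure_map hm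

lemma IsGAF.isProbabilityMeasure_stdComplexGaussian {G : Ω → EntireFun} (hG : IsGAF P G) :
    IsProbabilityMeasure stdComplexGaussian := by
  obtain ⟨ξ, hlaw, hind, -⟩ := hG
  have := hind.isProbabilityMeasure
  rw [← (hlaw 0).map_eq]
  exact Measure.isProbabilityMeasure_map (hlaw 0).aemeasurable

/-- Fock-space translation invariance of the GAF together with the independence of its value at
`0` from the rest: resampling `G(0)` and translating by `a` does not change the law. -/
lemma IsGAF.map_resetAt {G : Ω → EntireFun} (hG : IsGAF P G) (a : ℂ) :
    (stdComplexGaussian.prod (P.map G)).map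
      (fun p => resetAt a (Complex.exp (starRingEnd ℂ a * a / 2) * p.1) p.2) = P.map G := by
  have := hG.isProbabilityMeasure_map
  have := hG.isProbabilityMeasure_stdComplexGaussian
  have hm : Measurable fun p : ℂ × EntireFun =>
      resetAt a (Complex.exp (starRingEnd ℂ a * a / 2) * p.1) p.2 :=
    (measurable_fst.const_mul _).resetAt measurable_snd a
  have := Measure.isProbabilityMeasure_map (μ := stdComplexGaussian.prod (P.map G)) hm.aemeasurable
  refine measure_ext_entireFun fun I c => ?_
  have hmI : Measurable fun g : EntireFun =>
      Complex.exp (((∑ i, c i * g.1 i.1).re : ℝ) * Complex.I) := by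
    have : Measurable fun g : EntireFun => ∑ i, c i * g.1 i.1 :=
      Finset.measurable_fun_sum _ fun i _ => (measurable_entireFun_eval i.1).const_mul _
    exact (Complex.measurable_exp.comp ((Complex.measurable_ofReal.comp
      (Complex.measurable_re.comp this)).mul_const _))
  rw [integral_map hm.aemeasurable hmI.aestronglyMeasurable,
    hG.integral_exp_re_map c (fun i : I => i.1), ← gafCov_fockShift_reset a]
  set d : I → ℂ := fun i =>
      c i * Complex.exp (starRingEnd ℂ a * i.1 - starRingEnd ℂ a * a / 2) with hd
  have hsplit : ∀ p : ℂ × EntireFun, Complex.exp (((∑ i, c i *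
      (resetAt a (Complex.exp (starRingEnd ℂ a * a / 2) * p.1) p.2).1 i.1).re : ℝ) * Complex.I) =
      Complex.exp ((((∑ i, d i) * p.1).re : ℝ) * Complex.I) *
      Complex.exp (((∑ o : Option I, (o.elim (-∑ i, d i) d) *
        p.2.1 (o.elim 0 fun i => i.1 - a)).re : ℝ) * Complex.I) := by
    intro p
    rw [← Complex.exp_add, ← add_mul, ← Complex.ofReal_add, ← Complex.add_re]
    congr 4
    simp only [Fintype.sum_option, Option.elim_none, Option.elim_some, resetAt, fockShiftEntire,
      fockShift, resetAtZero]
    rw [← mul_assoc, ← Complex.exp_add, neg_add_cancel, Complex.exp_zero, one_mul, neg_mul,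
      Finset.sum_mul, Finset.sum_mul, ← Finset.sum_neg_distrib, ← Finset.sum_add_distrib,
      ← Finset.sum_add_distrib]
    refine Finset.sum_congr rfl fun i _ => ?_
    simp only [hd]
    ring
  simp only [hsplit]
  rw [integral_prod_mul (fun z : ℂ => Complex.exp ((((∑ i, d i) * z).re : ℝ) * Complex.I))
    (fun g : EntireFun => Complex.exp (((∑ o : Option I, (o.elim (-∑ i, d i) d) *
        g.1 (o.elim 0 fun i => i.1 - a)).re : ℝ) * Complex.I)),
    integral_exp_re_mul_stdComplexGaussian,
    hG.integral_exp_re_map (fun o : Option I => o.elim (-∑ i, d i) d)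
      (fun o => o.elim 0 fun i => i.1 - a), ← Complex.exp_add, ← Complex.ofReal_add]
  congr 2
  ring

/-- The law of `G(a)`, a centred complex Gaussian of variance `exp |a|²`. -/
noncomputable def gafValueLaw (a : ℂ) : Measure ℂ :=
  stdComplexGaussian.map fun z => Complex.exp (starRingEnd ℂ a * a / 2) * z

instance isOpenPosMeasure_gafValueLaw (a : ℂ) : (gafValueLaw a).IsOpenPosMeasure := by
  have := volume_absolutelyContinuous_stdComplexGaussian.isOpenPosMeasure
  refine Continuous.isOpenPosMeasure_map (by fun_prop) fun w =>
    ⟨(Complex.exp (starRingEnd ℂ a * a / 2))⁻¹ * w, ?_⟩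
  exact mul_inv_cancel_left₀ (Complex.exp_ne_zero _) w

lemma IsGAF.map_prodMk {G : Ω → EntireFun} (hG : IsGAF P G) (a : ℂ)
    [IsProbabilityMeasure (P.map G)] :
    P.map (fun ω => ((G ω).1 a, G ω)) = (gafValueLaw a).compProd (resetKernel a (P.map G)) := by
  have := hG.isProbabilityMeasure_stdComplexGaussian
  have he : Measurable fun g : EntireFun => (g.1 a, g) :=
    (measurable_entireFun_eval a).prodMk measurable_id
  have hs : Measurable fun z : ℂ => Complex.exp (starRingEnd ℂ a * a / 2) * z :=
    measurable_const_mul _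
  have : IsProbabilityMeasure (gafValueLaw a) :=
    Measure.isProbabilityMeasure_map hs.aemeasurable
  have hm : Measurable fun p : ℂ × EntireFun =>
      resetAt a (Complex.exp (starRingEnd ℂ a * a / 2) * p.1) p.2 :=
    (measurable_fst.const_mul _).resetAt measurable_snd a
  have h1 : P.map (fun ω => ((G ω).1 a, G ω)) = (P.map G).map fun g => (g.1 a, g) :=
    (AEMeasurable.map_map_of_aemeasurable he.aemeasurable hG.aemeasurable).symm
  rw [h1, compProd_resetKernel]
  have h2 : (gafValueLaw a).prod (P.map G) = (stdComplexGaussian.prod (P.map G)).map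
      (Prod.map (fun z : ℂ => Complex.exp (starRingEnd ℂ a * a / 2) * z) id) := by
    rw [← Measure.map_prod_map _ _ hs measurable_id, Measure.map_id]
    rfl
  rw [h2, Measure.map_map (measurable_fst.prodMk (measurable_resetAt a))
    (hs.prodMap measurable_id)]
  conv_lhs => rw [← hG.map_resetAt a]
  rw [Measure.map_map he hm]
  congr 1
  funext p
  exact Prod.ext (resetAt_apply_self a _ _) rfl

lemma IsGAF.map_eval {G : Ω → EntireFun} (hG : IsGAF P G) (a : ℂ) :
    P.map (fun ω => (G ω).1 a) = gafValueLaw a := by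
  have := hG.isProbabilityMeasure_map
  have := hG.isProbabilityMeasure_stdComplexGaussian
  have hs : Measurable fun z : ℂ => Complex.exp (starRingEnd ℂ a * a / 2) * z :=
    measurable_const_mul _
  have : IsProbabilityMeasure (gafValueLaw a) :=
    Measure.isProbabilityMeasure_map hs.aemeasurable
  have h := congrArg Measure.fst (hG.map_prodMk a)
  rw [Measure.fst_compProd] at h
  rw [← h, Measure.fst, AEMeasurable.map_map_of_aemeasurable measurable_fst.aemeasurable]
  · rfl
  · exact ((measurable_entireFun_eval a).comp_aemeasurable hG.aemeasurable).prodMk hG.aemeasurable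

lemma IsGAF.isLawGivenZeroAt_resetKernel {G : Ω → EntireFun} (hG : IsGAF P G) (a : ℂ)
    [IsProbabilityMeasure (P.map G)] :
    IsLawGivenZeroAt P G a (resetKernel a (P.map G) 0) :=
  ⟨resetKernel a (P.map G), inferInstance, by rw [hG.map_prodMk, hG.map_eval],
    fun _ z f => (continuous_integral_resetKernel a _ z f).continuousAt, rfl⟩

/-- Two disintegrations agree almost everywhere on a test function; by continuity at `0` and
because the base measure charges every neighbourhood of `0`, they agree at `0` itself. -/
lemma integral_kernel_zero_eq {m : Measure ℂ} [IsProbabilityMeasure m] [m.IsOpenPosMeasure]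
    {κ κ' : Kernel ℂ EntireFun} [IsMarkovKernel κ] [IsMarkovKernel κ']
    (h : m.compProd κ = m.compProd κ') {φ : EntireFun → ℝ} (hφ : Measurable φ) {M : ℝ}
    (hM : ∀ g, ‖φ g‖ ≤ M) (hc : ContinuousAt (fun w => ∫ g, φ g ∂(κ w)) 0)
    (hc' : ContinuousAt (fun w => ∫ g, φ g ∂(κ' w)) 0) :
    ∫ g, φ g ∂(κ 0) = ∫ g, φ g ∂(κ' 0) := by
  have hint : ∀ η : Kernel ℂ EntireFun, IsMarkovKernel η →
      Integrable (fun p : ℂ × EntireFun => φ p.2) (m.compProd η) := fun η _ =>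
    Integrable.of_bound (hφ.comp measurable_snd).aestronglyMeasurable M
      (Filter.Eventually.of_forall fun p => hM p.2)
  have hae : (fun w => ∫ g, φ g ∂(κ w)) =ᵐ[m] fun w => ∫ g, φ g ∂(κ' w) := by
    refine Integrable.ae_eq_of_forall_setIntegral_eq _ _ (hint κ inferInstance).integral_compProd
      (hint κ' inferInstance).integral_compProd fun s hs _ => ?_
    have e : ∀ η : Kernel ℂ EntireFun, IsMarkovKernel η → ∫ w in s, ∫ g, φ g ∂(η w) ∂m =
        ∫ p in s ×ˢ Set.univ, φ p.2 ∂(m.compProd η) := fun η _ => by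
      rw [Measure.setIntegral_compProd hs MeasurableSet.univ (hint η inferInstance).integrableOn]
      simp
    rw [e κ inferInstance, e κ' inferInstance, h]
  by_contra hne
  have hev := (hc.sub hc').eventually_ne (sub_ne_zero.2 hne)
  refine (Measure.measure_pos_of_mem_nhds m hev).ne' ?_
  refine measure_mono_null (fun w hw => ?_) hae
  exact fun h' => hw (sub_eq_zero.2 h')

lemma IsGAF.isLawGivenZeroAt_unique {G : Ω → EntireFun} (hG : IsGAF P G) {a : ℂ}
    {ν ν' : Measure EntireFun} (h : IsLawGivenZeroAt P G a ν) (h' : IsLawGivenZeroAt P G a ν') :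
    ν = ν' := by
  obtain ⟨κ, hκ, hj, hc, rfl⟩ := h
  obtain ⟨κ', hκ', hj', hc', rfl⟩ := h'
  rw [hG.map_eval] at hj hj'
  have := hG.isProbabilityMeasure_stdComplexGaussian
  have : IsProbabilityMeasure (gafValueLaw a) :=
    Measure.isProbabilityMeasure_map (measurable_const_mul _).aemeasurable
  refine measure_ext_entireFun fun I c => ?_
  let e := I.equivFin.symm
  let L : (Fin I.card → ℂ) → ℝ := fun v => (∑ k, c (e k) * v k).re
  have hL : Continuous L := by fun_prop
  have hLe : ∀ g : EntireFun, (∑ i, c i * g.1 i.1).re = L fun k => g.1 (e k).1 := fun g => by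
    simp only [L]
    rw [Equiv.sum_comp e (fun i => c i * g.1 i.1)]
  have key : ∀ u : ℝ → ℝ, Continuous u → (∀ x, ‖u x‖ ≤ 1) →
      ∫ g, u (∑ i, c i * g.1 i.1).re ∂(κ 0) = ∫ g, u (∑ i, c i * g.1 i.1).re ∂(κ' 0) := by
    intro u hu hu1
    let f : BoundedContinuousFunction (Fin I.card → ℂ) ℝ :=
      BoundedContinuousFunction.ofNormedAddCommGroup (fun v => u (L v)) (hu.comp hL) 1
        fun v => hu1 _
    have h1 := hc _ (fun k => (e k).1) f
    have h2 := hc' _ (fun k => (e k).1) f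
    simp only [hLe]
    refine integral_kernel_zero_eq (hj.symm.trans hj') ?_ (fun g => hu1 _) h1 h2
    exact (hu.comp hL).measurable.comp
      (measurable_pi_iff.2 fun k => measurable_entireFun_eval _)
  have hmeas : Measurable fun g : EntireFun => (∑ i, c i * g.1 i.1).re :=
    Complex.measurable_re.comp
      (Finset.measurable_fun_sum _ fun i _ => (measurable_entireFun_eval i.1).const_mul _)
  have hexp : ∀ η : Measure EntireFun, IsProbabilityMeasure η →
      ∫ g, Complex.exp (((∑ i, c i * g.1 i.1).re : ℝ) * Complex.I) ∂η =
      ((∫ g, Real.cos (∑ i, c i * g.1 i.1).re ∂η : ℝ) : ℂ) +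
        ((∫ g, Real.sin (∑ i, c i * g.1 i.1).re ∂η : ℝ) : ℂ) * Complex.I := by
    intro η _
    have i1 : Integrable (fun g : EntireFun => Real.cos (∑ i, c i * g.1 i.1).re) η :=
      Integrable.of_bound (Real.measurable_cos.comp hmeas).aestronglyMeasurable 1
        (Filter.Eventually.of_forall fun g => Real.abs_cos_le_one _)
    have i2 : Integrable (fun g : EntireFun => Real.sin (∑ i, c i * g.1 i.1).re) η :=
      Integrable.of_bound (Real.measurable_sin.comp hmeas).aestronglyMeasurable 1
        (Filter.Eventually.of_forall fun g => Real.abs_sin_le_one _)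
    rw [← integral_complex_ofReal, ← integral_complex_ofReal, ← integral_mul_const,
      ← integral_add i1.ofReal (i2.ofReal.mul_const _)]
    refine integral_congr_ae (Filter.Eventually.of_forall fun g => ?_)
    simp [Complex.exp_mul_I]
  rw [hexp _ inferInstance, hexp _ inferInstance, key _ Real.continuous_cos Real.abs_cos_le_one,
    key _ Real.continuous_sin Real.abs_sin_le_one]

end

/-! ### Zero paths of the conditioned function -/

section

variable {Ω : Type*} [MeasurableSpace Ω] {P : Measure Ω}

/-- The law of `g - g(0)` under `μ`; for the GAF, its law conditioned on vanishing at `0`. -/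
noncomputable def pinnedLaw (μ : Measure EntireFun) : Measure EntireFun := μ.map (resetAtZero 0)

lemma measurable_resetAtZero (w : ℂ) : Measurable (resetAtZero w) :=
  measurable_entireFun_iff.2 fun z =>
    ((measurable_entireFun_eval z).sub (measurable_entireFun_eval 0)).const_add w

lemma map_fockShiftEntire_neg_resetKernel (a : ℂ) (μ : Measure EntireFun) [IsProbabilityMeasure μ] :
    (resetKernel a μ 0).map (fockShiftEntire (-a)) = pinnedLaw μ := by
  rw [resetKernel_apply, Measure.map_map (measurable_fockShiftEntire _)
    (measurable_resetAt_right a 0), pinnedLaw]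
  congr 1
  funext g
  simp [resetAt, fockShiftEntire_neg_fockShiftEntire]

lemma iteratedDeriv_succ_resetAtZero (w : ℂ) (g : EntireFun) (n : ℕ) :
    iteratedDeriv (n + 1) (resetAtZero w g).1 = iteratedDeriv (n + 1) g.1 := by
  have h : deriv (resetAtZero w g).1 = deriv g.1 := by
    funext z
    simp [resetAtZero]
  rw [iteratedDeriv_succ', iteratedDeriv_succ', h]

lemma IsGAF.ae_mem_regularZeroSet {G : Ω → EntireFun} (hG : IsGAF P G) :
    ∀ᵐ g ∂(pinnedLaw (P.map G)), g ∈ regularZeroSet := by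
  rw [pinnedLaw, AEMeasurable.map_map_of_aemeasurable (measurable_resetAtZero 0).aemeasurable
    hG.aemeasurable, ae_map_iff (p := (· ∈ regularZeroSet))
    ((measurable_resetAtZero 0).comp_aemeasurable hG.aemeasurable)
    measurableSet_regularZeroSet]
  filter_upwards [hG.ae_regular] with ω ⟨⟨C, hC⟩, h1⟩
  refine ⟨⟨C, fun n => ?_⟩, by simp [resetAtZero], ?_⟩
  · match n with
    | 0 => simp [resetAtZero]
    | n + 1 =>
      simp only [Function.comp_apply, iteratedDeriv_succ_resetAtZero]
      exact hC (n + 1)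
  · have := iteratedDeriv_succ_resetAtZero 0 (G ω) 0
    rw [zero_add, iteratedDeriv_one, iteratedDeriv_one] at this
    rw [Function.comp_apply, this]
    exact h1

/-- The GAF conditioned to vanish at `a`, translated back to the origin, has a law which does not
depend on `a`. -/
lemma IsConditionedAt.hasLaw {G : Ω → EntireFun} (hG : IsGAF P G) {a : ℂ} {Ω₁ : Type*}
    [MeasurableSpace Ω₁] {P₁ : Measure Ω₁} {X : Ω₁ → EntireFun} (hX : IsConditionedAt P G a P₁ X) :
    HasLaw (fun ω => fockShiftEntire (-a) (X ω)) (pinnedLaw (P.map G)) P₁ := by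
  obtain ⟨ν, hν, hlaw⟩ := hX
  have := hG.isProbabilityMeasure_map
  have h := hG.isLawGivenZeroAt_unique hν (hG.isLawGivenZeroAt_resetKernel a)
  refine ⟨(measurable_fockShiftEntire _).comp_aemeasurable hlaw.aemeasurable, ?_⟩
  rw [← map_fockShiftEntire_neg_resetKernel a, ← h, ← hlaw.map_eq,
    AEMeasurable.map_map_of_aemeasurable (measurable_fockShiftEntire _).aemeasurable
      hlaw.aemeasurable]
  rfl

lemma IsConditionedAt.ae_mem_regularZeroSet {G : Ω → EntireFun} (hG : IsGAF P G) {a : ℂ}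
    {Ω₁ : Type*} [MeasurableSpace Ω₁] {P₁ : Measure Ω₁} {X : Ω₁ → EntireFun}
    (hX : IsConditionedAt P G a P₁ X) :
    ∀ᵐ ω ∂P₁, fockShiftEntire (-a) (X ω) ∈ regularZeroSet := by
  have h := hX.hasLaw hG
  refine ae_of_ae_map h.aemeasurable ?_
  rw [h.map_eq]
  exact hG.ae_mem_regularZeroSet

lemma IsHeatZeroPath.mono {F : ℂ → ℂ} {a : ℂ} {r s : ℝ} {ζ : ℂ → ℂ} (h : IsHeatZeroPath F a r ζ)
    (hs : s ≤ r) : IsHeatZeroPath F a s ζ :=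
  ⟨h.1.mono (ball_subset_ball hs), h.2.1, fun τ hτ => h.2.2 τ (ball_subset_ball hs hτ)⟩

lemma isHeatZeroPath_unshift {g : EntireFun} {a : ℂ}
    (hg : fockShiftEntire (-a) g ∈ regularZeroSet) {r : ℝ} (hr : r ≤ 1) (ζ : ℂ → ℂ) :
    IsHeatZeroPath g.1 a r ζ ↔ IsHeatZeroPath (fockShiftEntire (-a) g).1 0 r
      (fun τ => ζ τ - a - τ * starRingEnd ℂ a) := by
  rw [← (heatTame_of_mem_regularZeroSet hg).isHeatZeroPath_fockShift_iff a hr]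
  have := congrArg Subtype.val (fockShiftEntire_fockShiftEntire_neg a g)
  change fockShift a (fockShiftEntire (-a) g).1 = g.1 at this
  rw [this]

lemma apply_eq_zero_and_deriv_ne_zero {g : EntireFun} {a : ℂ}
    (hg : fockShiftEntire (-a) g ∈ regularZeroSet) : g.1 a = 0 ∧ deriv g.1 a ≠ 0 := by
  obtain ⟨-, h0, h1⟩ := hg
  have h := congrArg Subtype.val (fockShiftEntire_fockShiftEntire_neg a g)
  change fockShift a (fockShiftEntire (-a) g).1 = g.1 at h
  rw [← h, deriv_fockShift a (fockShiftEntire (-a) g).2]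
  constructor
  · simp [fockShift, h0]
  · simp only [fockShift, sub_self, twistedDeriv, h0]
    simpa [Complex.exp_ne_zero] using h1

lemma exists_isHeatZeroPath {g : EntireFun} {a : ℂ}
    (hg : fockShiftEntire (-a) g ∈ regularZeroSet) :
    ∃ r : ℝ, 0 < r ∧ ∃ ζ : ℂ → ℂ, IsHeatZeroPath g.1 a r ζ := by
  obtain ⟨r, hr, ζ, hζ⟩ := (heatTame_of_mem_regularZeroSet hg).exists_isHeatZeroPath hg.2.1 hg.2.2
  refine ⟨min r 1, lt_min hr one_pos, fun τ => ζ τ + a + τ * starRingEnd ℂ a, ?_⟩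
  rw [isHeatZeroPath_unshift hg (min_le_right _ _)]
  convert hζ.mono (min_le_left r 1) using 2 with τ
  ring

lemma isHeatZeroPath_eqOn {g : EntireFun} {a : ℂ}
    (hg : fockShiftEntire (-a) g ∈ regularZeroSet) {r s : ℝ} (hr : 0 < r) (hs : 0 < s)
    {ζ η : ℂ → ℂ} (hζ : IsHeatZeroPath g.1 a r ζ) (hη : IsHeatZeroPath g.1 a s η) :
    Set.EqOn ζ η (ball 0 (min r s)) := by
  have ht := heatTame_of_mem_regularZeroSet hg
  -- the heat flow is only controlled for `|τ| < 1`; beyond that the identity theorem takes over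
  have hm : 0 < min (min r s) 1 := lt_min (lt_min hr hs) one_pos
  have hζ' := (isHeatZeroPath_unshift hg (min_le_right _ _) ζ).1
    (hζ.mono ((min_le_left _ 1).trans (min_le_left r s)))
  have hη' := (isHeatZeroPath_unshift hg (min_le_right _ _) η).1
    (hη.mono ((min_le_left _ 1).trans (min_le_right r s)))
  have hloc : ζ =ᶠ[nhds 0] η := by
    filter_upwards [ball_mem_nhds (0 : ℂ) hm] with τ hτ
    have := (hζ'.hasSum ht hg.2.2 hτ).unique (hη'.hasSum ht hg.2.2 hτ)
    linear_combination this
  exact ((hζ.1.mono (ball_subset_ball (min_le_left r s))).analyticOnNhd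
    isOpen_ball).eqOn_of_preconnected_of_eventuallyEq
    ((hη.1.mono (ball_subset_ball (min_le_right r s))).analyticOnNhd isOpen_ball)
    (convex_ball _ _).isPreconnected (mem_ball_self (lt_min hr hs)) hloc

lemma taylorSeq_add {f h : ℂ → ℂ} {r : ℝ} (hr : 0 < r) (hf : DifferentiableOn ℂ f (ball 0 r))
    (hh : DifferentiableOn ℂ h (ball 0 r)) :
    taylorSeq (fun τ => f τ + h τ) = taylorSeq f + taylorSeq h := by
  funext k
  simp only [taylorSeq, Pi.add_apply]
  rw [iteratedDeriv_fun_add ((hf.analyticAt (ball_mem_nhds 0 hr)).contDiffAt)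
    ((hh.analyticAt (ball_mem_nhds 0 hr)).contDiffAt), add_div]

lemma taylorSeq_affine_add_heatZeroPath {g : EntireFun} (hg : g ∈ regularZeroSet) (a : ℂ)
    {ζ : ℂ → ℂ} (hζ : ∃ r : ℝ, 0 < r ∧ IsHeatZeroPath g.1 0 r ζ) :
    taylorSeq (fun τ => a + τ * starRingEnd ℂ a + ζ τ) =
      taylorSeq (fun τ => a + τ * starRingEnd ℂ a) + pathCoeff g.1 := by
  obtain ⟨r, hr, h⟩ := hζ
  rw [taylorSeq_add hr (by fun_prop) h.1,
    h.taylorSeq_eq (heatTame_of_mem_regularZeroSet hg) hg.2.2 hr]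

lemma taylorSeq_eq_of_isHeatZeroPath {g : EntireFun} {a : ℂ}
    (hg : fockShiftEntire (-a) g ∈ regularZeroSet) {ζ : ℂ → ℂ}
    (hζ : ∃ r : ℝ, 0 < r ∧ IsHeatZeroPath g.1 a r ζ) :
    taylorSeq ζ = taylorSeq (fun τ => a + τ * starRingEnd ℂ a) +
      pathCoeff (fockShiftEntire (-a) g).1 := by
  obtain ⟨r, hr, h⟩ := hζ
  have h' := (isHeatZeroPath_unshift hg (min_le_right r 1) ζ).1 (h.mono (min_le_left r 1))
  rw [← taylorSeq_affine_add_heatZeroPath hg a ⟨_, lt_min hr one_pos, h'⟩]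
  congr 1
  funext τ
  ring

/-- The condition on Taylor coefficients expressing that the zero path from `0` exists on the disk
of radius `r`, with the positions at times `t i`, shifted by `m i`, in `B`. -/
def pinnedEvent (r : ℝ) {n : ℕ} (m t : Fin n → ℂ) (B : Set (Fin n → ℂ)) : Set EntireFun :=
  {g | ConvergesOnBall (pathCoeff g.1) r ∧
    (fun i => m i + ∑' k, pathCoeff g.1 k * t i ^ k) ∈ B}

lemma measurableSet_pinnedEvent (r : ℝ) {n : ℕ} (m t : Fin n → ℂ) {B : Set (Fin n → ℂ)}
    (hB : MeasurableSet B) : MeasurableSet (pinnedEvent r m t B) := by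
  refine (measurableSet_convergesOnBall r).inter ?_
  have : Measurable fun g : EntireFun => fun i => m i + ∑' k, pathCoeff g.1 k * t i ^ k :=
    measurable_pi_iff.2 fun i => (Measurable.tsum fun k =>
      (measurable_pathCoeff k).mul_const _).const_add _
  exact this hB

lemma mem_heatZeroEvent_iff {Ω' : Type*} (X : Ω' → EntireFun) {a : ℂ} {ω : Ω'}
    (hg : fockShiftEntire (-a) (X ω) ∈ regularZeroSet) {r : ℝ} (hr : 0 < r) (hr1 : r ≤ 1)
    (m : ℂ → ℂ) {n : ℕ} (t : Fin n → ℂ) (ht : ∀ i, t i ∈ ball (0 : ℂ) r) (B : Set (Fin n → ℂ)) :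
    ω ∈ heatZeroEvent X a r m t B ↔ fockShiftEntire (-a) (X ω) ∈
      pinnedEvent r (fun i => m (t i) + (a + t i * starRingEnd ℂ a)) t B := by
  refine Iff.trans ?_ ((heatTame_of_mem_regularZeroSet hg).exists_isHeatZeroPath_iff hg.2.1 hg.2.2
    hr hr1 (fun i => m (t i) + (a + t i * starRingEnd ℂ a)) t ht B)
  constructor
  · rintro ⟨ζ, hζ, hB⟩
    refine ⟨_, (isHeatZeroPath_unshift hg hr1 ζ).1 hζ, ?_⟩
    convert hB using 2 with i
    ring
  · rintro ⟨ζ, hζ, hB⟩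
    refine ⟨fun τ => ζ τ + a + τ * starRingEnd ℂ a, (isHeatZeroPath_unshift hg hr1 _).2 ?_, ?_⟩
    · convert hζ using 2 with τ
      ring
    · convert hB using 2 with i
      ring

lemma measure_heatZeroEvent {ν : Measure EntireFun} {Ω₁ : Type*} [MeasurableSpace Ω₁]
    {P₁ : Measure Ω₁} {X : Ω₁ → EntireFun} {a : ℂ}
    (hlaw : HasLaw (fun ω => fockShiftEntire (-a) (X ω)) ν P₁)
    (hreg : ∀ᵐ ω ∂P₁, fockShiftEntire (-a) (X ω) ∈ regularZeroSet) {r : ℝ} (hr : 0 < r)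
    (hr1 : r ≤ 1) (m : ℂ → ℂ) {n : ℕ} (t : Fin n → ℂ) (ht : ∀ i, t i ∈ ball (0 : ℂ) r)
    {B : Set (Fin n → ℂ)} (hB : MeasurableSet B) :
    NullMeasurableSet (heatZeroEvent X a r m t B) P₁ ∧ P₁ (heatZeroEvent X a r m t B) =
      ν (pinnedEvent r (fun i => m (t i) + (a + t i * starRingEnd ℂ a)) t B) := by
  have hS := measurableSet_pinnedEvent r (fun i => m (t i) + (a + t i * starRingEnd ℂ a)) t hB
  have h : heatZeroEvent X a r m t B =ᵐ[P₁] (fun ω => fockShiftEntire (-a) (X ω)) ⁻¹'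
      pinnedEvent r (fun i => m (t i) + (a + t i * starRingEnd ℂ a)) t B := by
    filter_upwards [hreg] with ω hω
    exact propext (mem_heatZeroEvent_iff X hω hr hr1 m t ht B)
  refine ⟨(hlaw.aemeasurable.nullMeasurable hS).congr h.symm, ?_⟩
  rw [measure_congr h, ← hlaw.map_eq, Measure.map_apply_of_aemeasurable hlaw.aemeasurable hS]

lemma fockShiftEntire_neg_zero (g : EntireFun) : fockShiftEntire (-0) g = g :=
  Subtype.ext (funext fun z => by simp [fockShiftEntire, fockShift])

end

theorem theorem1p3 {Ω : Type*} [MeasurableSpace Ω] (P : Measure Ω) [IsProbabilityMeasure P]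
    (G : Ω → EntireFun) (hG : IsGAF P G) (a : ℂ) :
    -- the law of the GAF conditioned to vanish at `a` is well defined
    (∃! ν : Measure EntireFun, IsLawGivenZeroAt P G a ν) ∧
    -- the zero at `a` is almost surely simple, and `z^a` exists and is unique
    (∀ {Ω₁ : Type*} [MeasurableSpace Ω₁] (P₁ : Measure Ω₁) (X : Ω₁ → EntireFun),
      IsConditionedAt P G a P₁ X →
      ∀ᵐ ω ∂P₁, (X ω).1 a = 0 ∧ deriv (X ω).1 a ≠ 0 ∧
        (∃ r : ℝ, 0 < r ∧ ∃ ζ : ℂ → ℂ, IsHeatZeroPath (X ω).1 a r ζ) ∧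
        (∀ (r s : ℝ) (ζ η : ℂ → ℂ), 0 < r → 0 < s →
          IsHeatZeroPath (X ω).1 a r ζ → IsHeatZeroPath (X ω).1 a s η →
          Set.EqOn ζ η (ball 0 (min r s)))) ∧
    -- equality in distribution of `z^a(τ)` and `a + τ ā + z^0(τ)`
    (∀ {Ω₁ : Type*} [MeasurableSpace Ω₁] (P₁ : Measure Ω₁) (X : Ω₁ → EntireFun)
      {Ω₂ : Type*} [MeasurableSpace Ω₂] (P₂ : Measure Ω₂) (Y : Ω₂ → EntireFun),
      IsConditionedAt P G a P₁ X → IsConditionedAt P G 0 P₂ Y →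
      -- as random germs of holomorphic functions at `τ = 0`
      (∀ (za : Ω₁ → ℂ → ℂ) (z0 : Ω₂ → ℂ → ℂ),
        IsRandomHeatZero P₁ X a za → IsRandomHeatZero P₂ Y 0 z0 →
        IdentDistrib (fun ω => taylorSeq (za ω))
          (fun ω => taylorSeq (fun τ => a + τ * (starRingEnd ℂ) a + z0 ω τ)) P₁ P₂) ∧
      -- and as random functions on random disks: joint laws at times in a disk where they exist
      (∀ (r : ℝ), 0 < r → r ≤ 1 → ∀ (n : ℕ) (t : Fin n → ℂ), (∀ i, t i ∈ ball (0 : ℂ) r) →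
        ∀ B : Set (Fin n → ℂ), MeasurableSet B →
          NullMeasurableSet (heatZeroEvent X a r (fun _ => 0) t B) P₁ ∧
          NullMeasurableSet
            (heatZeroEvent Y 0 r (fun τ => a + τ * (starRingEnd ℂ) a) t B) P₂ ∧
          P₁ (heatZeroEvent X a r (fun _ => 0) t B) =
            P₂ (heatZeroEvent Y 0 r (fun τ => a + τ * (starRingEnd ℂ) a) t B))) := by
  have hμ := hG.isProbabilityMeasure_map
  refine ⟨⟨_, hG.isLawGivenZeroAt_resetKernel a, fun ν hν =>
    hG.isLawGivenZeroAt_unique hν (hG.isLawGivenZeroAt_resetKernel a)⟩, ?_, ?_⟩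
  · intro Ω₁ _ P₁ X hX
    filter_upwards [hX.ae_mem_regularZeroSet hG] with ω hω
    obtain ⟨h0, h1⟩ := apply_eq_zero_and_deriv_ne_zero hω
    exact ⟨h0, h1, exists_isHeatZeroPath hω, fun r s ζ η hr hs hζ hη =>
      isHeatZeroPath_eqOn hω hr hs hζ hη⟩
  · intro Ω₁ _ P₁ X Ω₂ _ P₂ Y hX hY
    have hXlaw := hX.hasLaw hG
    have hYlaw := hY.hasLaw hG
    have hXreg := hX.ae_mem_regularZeroSet hG
    have hYreg := hY.ae_mem_regularZeroSet hG
    refine ⟨fun za z0 hza hz0 => ?_, fun r hr hr1 n t ht B hB => ?_⟩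
    · simp only [fockShiftEntire_neg_zero] at hYlaw hYreg
      let Λ : EntireFun → ℕ → ℂ := fun g =>
        taylorSeq (fun τ => a + τ * starRingEnd ℂ a) + pathCoeff g.1
      have hΛ : Measurable Λ :=
        measurable_pi_iff.2 fun k => (measurable_pathCoeff k).const_add _
      have hI : IdentDistrib (fun ω => fockShiftEntire (-a) (X ω)) Y P₁ P₂ :=
        ⟨hXlaw.aemeasurable, hYlaw.aemeasurable, hXlaw.map_eq.trans hYlaw.map_eq.symm⟩
      have h1 : (fun ω => Λ (fockShiftEntire (-a) (X ω))) =ᵐ[P₁] fun ω => taylorSeq (za ω) := by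
        filter_upwards [hXreg, hza] with ω h h'
        exact (taylorSeq_eq_of_isHeatZeroPath h h').symm
      have h2 : (fun ω => Λ (Y ω)) =ᵐ[P₂]
          fun ω => taylorSeq (fun τ => a + τ * starRingEnd ℂ a + z0 ω τ) := by
        filter_upwards [hYreg, hz0] with ω h h'
        exact (taylorSeq_affine_add_heatZeroPath h a h').symm
      have hc := hI.comp hΛ
      exact ⟨hc.aemeasurable_fst.congr h1, hc.aemeasurable_snd.congr h2,
        (Measure.map_congr h1).symm.trans (hc.map_eq.trans (Measure.map_congr h2))⟩
    · obtain ⟨m1, e1⟩ := measure_heatZeroEvent hXlaw hXreg hr hr1 (fun _ => 0) t ht hB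
      obtain ⟨m2, e2⟩ := measure_heatZeroEvent hYlaw hYreg hr hr1
        (fun τ => a + τ * (starRingEnd ℂ) a) t ht hB
      refine ⟨m1, m2, ?_⟩
      rw [e1, e2]
      simp
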